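/- A quantum tensor network $\mathcal N=(G,d,s,t)$ consists of a finite undirected (simple) graph $G=(V,E)$, a capacity $d_e\in\mathbb N$, $d_e\ge 2$, for each edge $e$, a source $s$ and a sink $t\ne s$. The endpoints of each edge $e$ share the maximally entangled state $d_e^{-1/2}\sum_{i=1}^{d_e}|i\rangle|i\rangle$. The quantum min-cut $QMC(\mathcal N)$ is the minimum, over all partitions $V=\bar S\cup\bar T$ with $s\in\bar S$, $t\in\bar T$, of the product of the capacities of the edges between $\bar S$ and $\bar T$. A strict flow assigns to each ordered pair $(u,v)$ of adjacent vertices a natural number $f_{u,v}$ such that $1\le f_{u,v}f_{v,u}\le d_{\{u,v\}}$ for all adjacent $u,v$; $\prod_{u\sim v}f_{u,v}=\prod_{u\sim v}f_{v,u}$ for every $v\ne s,t$; and $f_{v,s}=1$ for all $v\sim s$, $f_{t,u}=1$ for all $u\sim t$. Its value is $|f|=\prod_{v\sim s}f_{s,v}\big/\prod_{v\sim s}f_{v,s}$, and $QMF_s(\mathcal N)$ is the maximum value of a strict flow. A teleportation protocol on $\mathcal N$ is a finite-round protocol of local quantum operations at the vertices and classical communication, as follows. There are finitely many walks (routes) $w_1,\dots,w_n$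 from $s$ to $t$ in $G$ and dimensions $p_1,\dots,p_n\ge1$; the input at $s$ consists of $n$ systems of dimensions $p_1,\dots,p_n$. First, in a preparatory phase, each step of which is a local operation at one endpoint of one edge, on that endpoint's half of the edge state and on its registers (initially in the state $|0\rangle$) reserved for the hops of the routes along this edge, the vertices may transform the edge states into entangled pairs for the hops. Then, for each $i$, the $i$-th input system is moved from $s$ to $t$ along $w_i$, hop by hop, by the standard $p_i$-dimensional quantum teleportation (a generalized Bell measurement at the sending vertex and a correction, depending on its outcome, at the receiving vertex). The protocol transmits a $D$-dimensional quantum system if $\prod_i p_i=D$ and the quantum channel from the input at $s$ to the output at $t$ which it implements over the edge states is exactly the identity channel of $\mathbb C^D$. Theorem. Let $\mathcal N$ be a quantum tensor network with $QMF_s(\mathcal N)=QMC(\mathcal N)$. Then there are a strict flow $f$ with $|f|=QMC(\mathcal N)$ and a teleportation protocol which transmits a $QMC(\mathcal N)$-dimensional quantum system from $s$ to $t$, such that all its dimensions $p_i$ are prime, all its routes $w_i$ are paths (no vertex is repeated), and, for all adjacent $u,v$, $f_{u,v}$ is the product of the $p_i$ over all $i$ for which $w_i$ traverses the edge from $u$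 to $v$. -/

import Mathlib

universe u w

/-! ### Quantum tensor networks, cuts and flows -/

/-- A quantum tensor network: an undirected graph with a source `s`, a sink `t`, and a capacity
`d e ≥ 2` on every edge `e`; the endpoints of `e` share a maximally entangled state of two
`d e`-dimensional systems. -/
structure QuantumTensorNetwork (V : Type u) where
  graph : SimpleGraph V
  d : Sym2 V → ℕ
  two_le_d : ∀ e ∈ graph.edgeSet, 2 ≤ d e
  s : V
  t : V
  s_ne_t : s ≠ t

namespace QuantumTensorNetwork

variable {V : Type u} [Fintype V] (N : QuantumTensorNetwork V)

open Classical in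
/-- The product of the capacities of the edges between `S` and its complement. -/
noncomputable def cutProduct (S : Finset V) : ℕ :=
  ∏ u ∈ S, ∏ v ∈ Sᶜ, if N.graph.Adj u v then N.d s(u, v) else 1

/-- The quantum min-cut: the least cut product over all cuts separating `s` from `t`. -/
noncomputable def qmc : ℕ :=
  sInf {D : ℕ | ∃ S : Finset V, N.s ∈ S ∧ N.t ∉ S ∧ D = N.cutProduct S}

open Classical in
/-- The product of the flows entering `v`. -/
noncomputable def inflow (f : V → V → ℕ) (v : V) : ℕ :=
  ∏ u, if N.graph.Adj u v then f u v else 1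

open Classical in
/-- The product of the flows leaving `v`. -/
noncomputable def outflow (f : V → V → ℕ) (v : V) : ℕ :=
  ∏ u, if N.graph.Adj v u then f v u else 1

/-- Quantum flows. Only the values of `f` on adjacent ordered pairs are relevant. -/
structure IsFlow (f : V → V → ℕ) : Prop where
  capacity : ∀ u v, N.graph.Adj u v → 1 ≤ f v u * f u v ∧ f v u * f u v ≤ N.d s(u, v)
  conservation : ∀ v, v ≠ N.s → v ≠ N.t → N.inflow f v = N.outflow f v

/-- Strict flows: nothing enters the source and nothing leaves the sink. -/
structure IsStrictFlow (f : V → V → ℕ) : Prop extends N.IsFlow f where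
  source : ∀ v, N.graph.Adj N.s v → f v N.s = 1
  sink : ∀ u, N.graph.Adj u N.t → f N.t u = 1

/-- The value of a flow. -/
noncomputable def flowValue (f : V → V → ℕ) : ℚ :=
  (N.outflow f N.s : ℚ) / (N.inflow f N.s : ℚ)

/-- The maximum value of a strict flow. -/
noncomputable def qmfStrict : ℝ :=
  sSup {x : ℝ | ∃ f : V → V → ℕ, N.IsStrictFlow f ∧ x = (N.flowValue f : ℝ)}

end QuantumTensorNetwork

/-! ### Local operations and classical communication -/

/-- Finite-round LOCC protocols on finitely many registers, where register `r` is located at the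
vertex `loc r` and has state space `ℂ ^ dim r`. In one step a vertex `v` performs a quantum
instrument, with Kraus operators `K o`, on a set `A` of registers located at `v`; the outcome `o`
is broadcast, and the rest of the protocol may depend on it. -/
inductive LOCC {V : Type u} {R : Type w} [DecidableEq R] (loc : R → V) (dim : R → ℕ) :
    Type (max u w 1)
  | done : LOCC loc dim
  | step (v : V) (A : Finset R) (hA : ∀ r ∈ A, loc r = v) (O : Type) [Fintype O]
      (K : O → Matrix (∀ r : A, Fin (dim r)) (∀ r : A, Fin (dim r)) ℂ)
      (hK : ∑ o, (K o).conjTranspose * K o = 1)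
      (next : O → LOCC loc dim) : LOCC loc dim

namespace LOCC

variable {V : Type u} {R : Type w} [DecidableEq R] {loc : R → V} {dim : R → ℕ}

/-- First `P`, then (whatever the outcomes were) `Q`. -/
def append : LOCC loc dim → LOCC loc dim → LOCC loc dim
  | done, Q => Q
  | step v A hA O K hK next, Q => step v A hA O K hK fun o => (next o).append Q

/-- Sequential composition of a list of protocols. -/
def seq (L : List (LOCC loc dim)) : LOCC loc dim := L.foldr append done

/-- Every step acts on a set of registers that satisfies `p`. -/
def StepsOn (p : Finset R → Prop) : LOCC loc dim → Prop
  | done => True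
  | step _ A _ _ _ _ next => p A ∧ ∀ o, (next o).StepsOn p

open Classical in
/-- The operator `K ⊗ 1` on all registers, where `K` acts on the registers in `A`. -/
noncomputable def lift (A : Finset R) (K : Matrix (∀ r : A, Fin (dim r)) (∀ r : A, Fin (dim r)) ℂ) :
    Matrix (∀ r, Fin (dim r)) (∀ r, Fin (dim r)) ℂ :=
  fun x y => if ∀ r, r ∉ A → x r = y r then K (fun r => x r) (fun r => y r) else 0

/-- The action of a protocol on the operators of the global state space, averaged over all
outcomes. -/
noncomputable def run [Fintype R] : LOCC loc dim →
    Matrix (∀ r, Fin (dim r)) (∀ r, Fin (dim r)) ℂ →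
    Matrix (∀ r, Fin (dim r)) (∀ r, Fin (dim r)) ℂ
  | done, σ => σ
  | step _ A _ _ K _ next, σ =>
      ∑ o, (next o).run (lift A (K o) * σ * (lift A (K o)).conjTranspose)

end LOCC

/-! ### The teleportation step -/

namespace Teleport

/-- `exp (2 π i / p)`. -/
noncomputable def omega (p : ℕ) : ℂ := Complex.exp (2 * Real.pi * Complex.I / p)

/-- Coordinates of the generalized Bell vector
`p ^ (-1/2) ∑ x, ω ^ (j x) |x⟩ |x + k mod p⟩`. -/
noncomputable def bell (p j k x y : ℕ) : ℂ :=
  if (x + k) % p = y then omega p ^ (j * x) / (Real.sqrt p : ℂ) else 0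

/-- Entries of the correction `|x + k mod p⟩ ↦ ω ^ (j x) |x⟩`. -/
noncomputable def correction (p j k y z : ℕ) : ℂ :=
  if (y + k) % p = z then omega p ^ (j * y) else 0

variable {V : Type u} {R : Type w} [DecidableEq R] {dim : R → ℕ}

/-- The projection of the registers `a`, `b` onto a generalized Bell vector. -/
noncomputable def bellProj (p j k : ℕ) (a b : R) :
    Matrix (∀ r : ({a, b} : Finset R), Fin (dim r)) (∀ r : ({a, b} : Finset R), Fin (dim r)) ℂ :=
  fun x y =>
    bell p j k (x ⟨a, by simp⟩) (x ⟨b, by simp⟩) *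
      (starRingEnd ℂ) (bell p j k (y ⟨a, by simp⟩) (y ⟨b, by simp⟩))

/-- The correction on the register `c`. -/
noncomputable def corrOp (p j k : ℕ) (c : R) :
    Matrix (∀ r : ({c} : Finset R), Fin (dim r)) (∀ r : ({c} : Finset R), Fin (dim r)) ℂ :=
  fun x y => correction p j k (x ⟨c, by simp⟩) (y ⟨c, by simp⟩)

theorem omega_prim {p : ℕ} (hp : p ≠ 0) : IsPrimitiveRoot (omega p) p :=
  Complex.isPrimitiveRoot_exp p hp

theorem omega_norm (p : ℕ) : ‖omega p‖ = 1 := by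
  have : (2 * Real.pi * Complex.I / p : ℂ) = ((2 * Real.pi / p : ℝ) : ℂ) * Complex.I := by
    push_cast; ring
  rw [omega, this, Complex.norm_exp_ofReal_mul_I]

theorem omega_pow_conj (p n : ℕ) :
    omega p ^ n * (starRingEnd ℂ) (omega p ^ n) = 1 := by
  rw [Complex.mul_conj, Complex.normSq_eq_norm_sq, norm_pow, omega_norm]; simp

theorem omega_orth {p : ℕ} (hp : p ≠ 0) {x y : ℕ} (hx : x < p) (hy : y < p) :
    ∑ j : Fin p, omega p ^ ((j : ℕ) * x) * (starRingEnd ℂ) (omega p ^ ((j : ℕ) * y)) =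
      if x = y then (p : ℂ) else 0 := by
  split_ifs with h
  · subst h
    simp only [omega_pow_conj]; simp
  · set z : ℂ := omega p ^ x * (starRingEnd ℂ) (omega p ^ y) with hz
    have h1 : ∀ j : Fin p, omega p ^ ((j : ℕ) * x) * (starRingEnd ℂ) (omega p ^ ((j : ℕ) * y))
        = z ^ (j : ℕ) := by
      intro j
      rw [hz, mul_pow, ← map_pow, ← pow_mul, ← pow_mul, mul_comm x, mul_comm y]
    simp only [h1]
    rw [Fin.sum_univ_eq_sum_range (fun j => z ^ j) p]
    have hz1 : z ≠ 1 := by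
      intro h2
      apply h
      apply (omega_prim hp).pow_inj hx hy
      have := omega_pow_conj p y
      calc omega p ^ x = omega p ^ x * (omega p ^ y * (starRingEnd ℂ) (omega p ^ y)) := by
            rw [this, mul_one]
        _ = z * omega p ^ y := by rw [hz]; ring
        _ = omega p ^ y := by rw [h2, one_mul]
    have hzp : z ^ p = 1 := by
      rw [hz, mul_pow, ← map_pow, ← pow_mul, ← pow_mul, mul_comm x, mul_comm y, pow_mul, pow_mul,
        (omega_prim hp).pow_eq_one]
      simp
    rw [geom_sum_eq hz1, hzp]; simp

theorem shift_unique {p k y z : ℕ} (hy : y < p) (hz : z < p) (h : (y + k) % p = (z + k) % p) :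
    y = z := by
  have : y ≡ z [MOD p] := Nat.ModEq.add_right_cancel' k h
  exact Nat.ModEq.eq_of_lt_of_lt this hy hz

theorem shift_exists {p k z : ℕ} (hk : k < p) (hz : z < p) :
    ∃ y : Fin p, ((y : ℕ) + k) % p = z := by
  have hp : 0 < p := by omega
  refine ⟨⟨(z + (p - k)) % p, Nat.mod_lt _ hp⟩, ?_⟩
  simp only [Nat.mod_add_mod]
  rw [show z + (p - k) + k = z + p by omega, Nat.add_mod_right, Nat.mod_eq_of_lt hz]

theorem shift_existsUnique {p x y : ℕ} (hx : x < p) (hy : y < p) :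
    ∃ k : Fin p, (x + (k : ℕ)) % p = y := by
  obtain ⟨k, hk⟩ := shift_exists hx hy
  exact ⟨k, by rw [add_comm]; exact hk⟩

theorem bell_complete {p : ℕ} {x x' y y' : ℕ} (hx : x < p) (hx' : x' < p)
    (hy : y < p) (hy' : y' < p) :
    ∑ o : Fin p × Fin p, bell p o.1 o.2 x x' * (starRingEnd ℂ) (bell p o.1 o.2 y y') =
      if x = y ∧ x' = y' then 1 else 0 := by
  have hp : p ≠ 0 := by omega
  have hpc : (p : ℂ) ≠ 0 := by exact_mod_cast hp
  have hs : ((Real.sqrt p : ℝ) : ℂ) * ((Real.sqrt p : ℝ) : ℂ) = p := by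
    rw [← Complex.ofReal_mul, Real.mul_self_sqrt (Nat.cast_nonneg p)]; simp
  rw [Fintype.sum_prod_type, Finset.sum_comm]
  have key : ∀ k : Fin p, ∑ j : Fin p, bell p j k x x' * (starRingEnd ℂ) (bell p j k y y') =
      if (x + (k : ℕ)) % p = x' ∧ (y + (k : ℕ)) % p = y' ∧ x = y then 1 else 0 := by
    intro k
    by_cases h1 : (x + (k : ℕ)) % p = x'
    · by_cases h2 : (y + (k : ℕ)) % p = y'
      · have : ∀ j : Fin p, bell p j k x x' * (starRingEnd ℂ) (bell p j k y y') =
            (omega p ^ ((j : ℕ) * x) * (starRingEnd ℂ) (omega p ^ ((j : ℕ) * y))) * (p : ℂ)⁻¹ := by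
          intro j
          rw [bell, bell, if_pos h1, if_pos h2, map_div₀, Complex.conj_ofReal, ← hs]
          ring
        simp only [this]
        rw [← Finset.sum_mul, omega_orth hp hx hy]
        by_cases h3 : x = y
        · rw [if_pos h3, if_pos ⟨h1, h2, h3⟩, mul_inv_cancel₀ hpc]
        · simp [h3]
      · simp [bell, h2]
    · simp [bell, h1]
  simp only [key]
  obtain ⟨k0, hk0⟩ := shift_existsUnique hx hx'
  rw [Finset.sum_eq_single k0]
  · congr 1
    apply propext
    constructor
    · rintro ⟨_, h2, h3⟩; subst h3; exact ⟨rfl, by rw [← hk0, h2]⟩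
    · rintro ⟨h1, h2⟩; subst h1; subst h2; exact ⟨hk0, hk0, rfl⟩
  · intro k _ hk
    rw [if_neg]
    rintro ⟨h1, _, _⟩
    apply hk
    apply Fin.ext
    apply shift_unique (k := x) k.2 k0.2
    rw [add_comm, h1, add_comm, hk0]
  · simp

theorem bell_norm {p : ℕ} {j k : ℕ} (hp : p ≠ 0) :
    ∑ z : Fin p × Fin p, (starRingEnd ℂ) (bell p j k z.1 z.2) * bell p j k z.1 z.2 = 1 := by
  have hpc : (p : ℂ) ≠ 0 := by exact_mod_cast hp
  have hs : ((Real.sqrt p : ℝ) : ℂ) * ((Real.sqrt p : ℝ) : ℂ) = p := by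
    rw [← Complex.ofReal_mul, Real.mul_self_sqrt (Nat.cast_nonneg p)]; simp
  rw [Fintype.sum_prod_type]
  have key : ∀ x : Fin p, ∑ y : Fin p, (starRingEnd ℂ) (bell p j k x y) * bell p j k x y =
      (p : ℂ)⁻¹ := by
    intro x
    rw [Finset.sum_eq_single ⟨((x : ℕ) + k) % p, Nat.mod_lt _ (Nat.pos_of_ne_zero hp)⟩]
    · rw [bell, if_pos rfl, map_div₀, Complex.conj_ofReal, div_mul_div_comm, hs, mul_comm,
        omega_pow_conj, one_div]
    · intro y _ hy
      rw [bell, if_neg]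
      · simp
      · intro h; exact hy (Fin.ext h.symm)
    · simp
  simp only [key]
  simp [hpc]

/-- Joint states of two distinct `p`-dimensional registers. -/
def pairEquiv {p : ℕ} {a b : R} (hab : a ≠ b) (ha : dim a = p) (hb : dim b = p) :
    (∀ r : ({a, b} : Finset R), Fin (dim r)) ≃ Fin p × Fin p where
  toFun x := (Fin.cast ha (x ⟨a, by simp⟩), Fin.cast hb (x ⟨b, by simp⟩))
  invFun z r :=
    if h : r.1 = a then Fin.cast (by rw [h, ha]) z.1
    else Fin.cast (by
      have := r.2
      simp only [Finset.mem_insert, Finset.mem_singleton] at this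
      rw [this.resolve_left h, hb]) z.2
  left_inv x := by
    funext r
    obtain ⟨r, hr⟩ := r
    have hr' := hr
    simp only [Finset.mem_insert, Finset.mem_singleton] at hr'
    rcases hr' with rfl | rfl
    · simp
    · simp [hab.symm]
  right_inv z := by
    ext <;> simp [hab.symm]

theorem bellProj_complete {p : ℕ} {a b : R} (hab : a ≠ b) (ha : dim a = p) (hb : dim b = p)
    (hp : p ≠ 0) :
    ∑ o : Fin p × Fin p, (bellProj (dim := dim) p o.1 o.2 a b).conjTranspose *
      bellProj p o.1 o.2 a b = 1 := by
  ext x y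
  have hsq : ∀ o : Fin p × Fin p,
      ((bellProj (dim := dim) p o.1 o.2 a b).conjTranspose *
          bellProj (dim := dim) p o.1 o.2 a b : Matrix _ _ ℂ) x y =
        bell p o.1 o.2 (x ⟨a, by simp⟩) (x ⟨b, by simp⟩) *
          (starRingEnd ℂ) (bell p o.1 o.2 (y ⟨a, by simp⟩) (y ⟨b, by simp⟩)) := by
    intro o
    have h1 : ∑ z : (∀ r : ({a, b} : Finset R), Fin (dim r)),
        (starRingEnd ℂ) (bell p o.1 o.2 (z ⟨a, by simp⟩) (z ⟨b, by simp⟩)) *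
          bell p o.1 o.2 (z ⟨a, by simp⟩) (z ⟨b, by simp⟩) = 1 := by
      rw [← bell_norm (j := o.1) (k := o.2) hp]
      exact Fintype.sum_equiv (pairEquiv hab ha hb) _ _ (fun z => rfl)
    rw [Matrix.mul_apply]
    conv_rhs => rw [← mul_one (bell p o.1 o.2 (x ⟨a, by simp⟩) (x ⟨b, by simp⟩) * _), ← h1,
      Finset.mul_sum]
    refine Finset.sum_congr rfl fun z _ => ?_
    simp only [Matrix.conjTranspose_apply, bellProj, RCLike.star_def, map_mul, Complex.conj_conj]
    ring
  rw [Matrix.sum_apply]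
  simp only [hsq]
  rw [bell_complete (by rw [← ha]; exact Fin.is_lt _) (by rw [← hb]; exact Fin.is_lt _)
    (by rw [← ha]; exact Fin.is_lt _) (by rw [← hb]; exact Fin.is_lt _), Matrix.one_apply]
  congr 1
  apply propext
  rw [← (pairEquiv (dim := dim) hab ha hb).injective.eq_iff, Prod.ext_iff]
  simp [pairEquiv, Fin.ext_iff]

theorem corrOp_unitary {p j k : ℕ} {c : R} (hc : dim c = p) (hk : k < p) :
    (corrOp (dim := dim) p j k c).conjTranspose * corrOp p j k c = 1 := by
  subst hc
  ext x y
  let E : (∀ r : ({c} : Finset R), Fin (dim r)) ≃ Fin (dim c) :=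
    { toFun := fun x => x ⟨c, by simp⟩
      invFun := fun z r => Fin.cast (by
        have := r.2
        rw [Finset.mem_singleton] at this
        rw [this]) z
      left_inv := fun x => by
        funext r
        obtain ⟨r, hr⟩ := r
        have hr' := hr
        rw [Finset.mem_singleton] at hr'
        subst hr'
        rfl
      right_inv := fun z => rfl }
  rw [Matrix.mul_apply]
  have h1 : ∑ z, (corrOp (dim := dim) (dim c) j k c).conjTranspose x z * corrOp (dim c) j k c z y =
      ∑ z : Fin (dim c), (starRingEnd ℂ) (correction (dim c) j k z (E x)) *
        correction (dim c) j k z (E y) :=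
    Fintype.sum_equiv E _ _ (fun z => rfl)
  have h2 : (1 : Matrix (∀ r : ({c} : Finset R), Fin (dim r)) _ ℂ) x y =
      if E x = E y then 1 else 0 := by
    rw [Matrix.one_apply]
    congr 1
    exact propext E.injective.eq_iff.symm
  rw [h1, h2]
  obtain ⟨w, hw⟩ := shift_exists hk (E x).2
  rw [Finset.sum_eq_single w]
  · rw [correction, if_pos hw, correction]
    by_cases h : E x = E y
    · rw [if_pos (by rw [hw, h]), if_pos h, mul_comm, omega_pow_conj]
    · rw [if_neg (by rw [hw]; exact fun h' => h (Fin.ext h')), if_neg h, mul_zero]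
  · intro z _ hz
    rw [correction, if_neg]
    · simp
    · intro h
      exact hz (Fin.ext (shift_unique z.2 w.2 (h.trans hw.symm)))
  · simp

variable {loc : R → V}

/-- Teleportation of a `p`-dimensional system from the register `a` to the register `c`, using an
entangled pair on `b`, `c`: the vertex `u` measures `a`, `b` in the generalized Bell basis, and the
vertex `v` applies the correction belonging to the outcome `(j, k)` to `c`. -/
noncomputable def teleport (p : ℕ) (u v : V) (a b c : R) (hab : a ≠ b)
    (ha : loc a = u) (hb : loc b = u) (hc : loc c = v)
    (da : dim a = p) (db : dim b = p) (dc : dim c = p) (hp : p ≠ 0) : LOCC loc dim :=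
  .step u {a, b} (by simp [ha, hb]) (Fin p × Fin p) (fun o => bellProj p o.1 o.2 a b)
    (bellProj_complete hab da db hp) fun o =>
      .step v {c} (by simp [hc]) Unit (fun _ => corrOp p o.1 o.2 c)
        (by simpa using corrOp_unitary dc o.2.2) fun _ => .done

end Teleport

/-! ### Teleportation protocols on a network -/

namespace QuantumTensorNetwork

variable {V : Type u}

/-- Finitely many walks from the source to the sink; the `i`-th one is to carry a system of
dimension `dim i`. -/
structure Routing (N : QuantumTensorNetwork V) where
  n : ℕ
  dim : Fin n → ℕ
  dim_pos : ∀ i, 0 < dim i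
  route : ∀ _ : Fin n, N.graph.Walk N.s N.t

namespace Routing

variable {N : QuantumTensorNetwork V} (ρ : Routing N)

open Classical in
/-- The total dimension that the routes carry along the directed edge `a`. -/
noncomputable def load (a : N.graph.Dart) : ℕ :=
  ∏ i, ρ.dim i ^ (ρ.route i).darts.count a

/-- The registers:
* `edge a`, for an edge with a direction `a`: the half of the state of that edge which is held by
  the first vertex of `a`;
* `msg i k`: held by the `k`-th vertex of the `i`-th route. The registers `msg i 0` are the input
  at the source, the last ones are the output at the sink, and `msg i (k + 1)` is the receiver's
  half of the pair used for the `k`-th hop of the `i`-th route;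
* `anc i k`: the sender's half of that pair, held by the `k`-th vertex of the `i`-th route. -/
inductive Reg : Type u
  | edge (a : N.graph.Dart) : Reg
  | msg (i : Fin ρ.n) (k : Fin ((ρ.route i).length + 1)) : Reg
  | anc (i : Fin ρ.n) (k : Fin (ρ.route i).length) : Reg

noncomputable instance : DecidableEq ρ.Reg := Classical.decEq _

instance [Fintype V] : Finite ρ.Reg := by
  classical
  let g : N.graph.Dart ⊕ (Σ i : Fin ρ.n, Fin ((ρ.route i).length + 1)) ⊕
      (Σ i : Fin ρ.n, Fin (ρ.route i).length) → ρ.Reg :=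
    Sum.elim Reg.edge (Sum.elim (fun x => Reg.msg x.1 x.2) (fun x => Reg.anc x.1 x.2))
  refine Finite.of_surjective g ?_
  rintro (a | ⟨i, k⟩ | ⟨i, k⟩)
  · exact ⟨.inl a, rfl⟩
  · exact ⟨.inr (.inl ⟨i, k⟩), rfl⟩
  · exact ⟨.inr (.inr ⟨i, k⟩), rfl⟩

noncomputable instance [Fintype V] : Fintype ρ.Reg := Fintype.ofFinite _

/-- The vertex that holds a register. -/
def loc : ρ.Reg → V
  | .edge a => a.fst
  | .msg i k => (ρ.route i).getVert k
  | .anc i k => (ρ.route i).getVert k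

/-- The dimension of a register. -/
def regDim : ρ.Reg → ℕ
  | .edge a => N.d a.edge
  | .msg i _ => ρ.dim i
  | .anc i _ => ρ.dim i

/-- The registers which the first vertex of `a` holds on account of the edge of `a`: its half of
the state of the edge, and its halves of the pairs for hops along this edge, in either
direction. The input registers belong to no edge. -/
def OnDart (a : N.graph.Dart) : ρ.Reg → Prop
  | .edge b => b = a
  | .msg i k => ∃ j : Fin (ρ.route i).length, k = j.succ ∧
      a.fst = (ρ.route i).getVert (j + 1) ∧ a.snd = (ρ.route i).getVert j
  | .anc i j => a.fst = (ρ.route i).getVert j ∧ a.snd = (ρ.route i).getVert (j + 1)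

/-- Teleportation along the `k`-th hop of the `i`-th route. -/
noncomputable def hop (i : Fin ρ.n) (k : Fin (ρ.route i).length) : LOCC ρ.loc ρ.regDim :=
  Teleport.teleport (ρ.dim i) ((ρ.route i).getVert k) ((ρ.route i).getVert (k + 1))
    (.msg i k.castSucc) (.anc i k) (.msg i k.succ) (by simp) rfl rfl rfl rfl rfl rfl
    (ρ.dim_pos i).ne'

/-- Route after route, hop after hop, the systems are teleported from `s` to `t`. -/
noncomputable def teleportAll : LOCC ρ.loc ρ.regDim :=
  LOCC.seq ((List.finRange ρ.n).flatMap fun i => (List.finRange (ρ.route i).length).map (ρ.hop i))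

/-- Joint configurations of all registers (a basis of the global state space). -/
abbrev Config : Type u := ∀ r : ρ.Reg, Fin (ρ.regDim r)

/-- Configuration of the input registers. -/
def inputs (x : ρ.Config) : ∀ i, Fin (ρ.dim i) := fun i => x (.msg i 0)

/-- Configuration of the output registers. -/
def outputs (x : ρ.Config) : ∀ i, Fin (ρ.dim i) := fun i => x (.msg i (Fin.last _))

variable [Fintype V]

open Classical in
/-- The initial state of all registers except the inputs: the two halves of every edge `e` are in
the maximally entangled state `(d e) ^ (-1/2) ∑ i, |i⟩ |i⟩`, all others are in the state `|0⟩`. -/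
noncomputable def resource (x : ρ.Config) : ℂ :=
  if (∀ a : N.graph.Dart, (x (.edge a) : ℕ) = x (.edge a.symm)) ∧
      (∀ i k, (x (.msg i (Fin.succ k)) : ℕ) = 0) ∧ (∀ i k, (x (.anc i k) : ℕ) = 0)
  then ∏ e ∈ N.graph.edgeFinset, ((Real.sqrt (N.d e) : ℝ) : ℂ)⁻¹ else 0

/-- The global initial state when the input system is in the state `τ`; the `D`-dimensional input
system is identified with the input registers by `enc`. -/
noncomputable def initial {D : ℕ} (enc : Fin D ≃ ∀ i, Fin (ρ.dim i))
    (τ : Matrix (Fin D) (Fin D) ℂ) : Matrix ρ.Config ρ.Config ℂ :=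
  fun x y => τ (enc.symm (ρ.inputs x)) (enc.symm (ρ.inputs y)) *
    (ρ.resource x * (starRingEnd ℂ) (ρ.resource y))

open Classical in
/-- The reduced state of the output registers (partial trace over all others). -/
noncomputable def reduced {D : ℕ} (enc : Fin D ≃ ∀ i, Fin (ρ.dim i))
    (σ : Matrix ρ.Config ρ.Config ℂ) : Matrix (Fin D) (Fin D) ℂ :=
  fun a b => ∑ x : ρ.Config, ∑ y : ρ.Config,
    if ρ.outputs x = enc a ∧ ρ.outputs y = enc b ∧
        (∀ r, (∀ i, r ≠ .msg i (Fin.last _)) → x r = y r)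
    then σ x y else 0

end Routing

/-- A teleportation protocol on a network: systems are teleported along routes from `s` to `t`. The
pairs needed for that come out of the edge states in a preparatory LOCC phase, each of whose steps
acts at one vertex, on the registers belonging to one of its edges. -/
structure TeleportationProtocol (N : QuantumTensorNetwork V) extends Routing N where
  prep : LOCC toRouting.loc toRouting.regDim
  prep_on : prep.StepsOn fun A => ∃ a, ∀ r ∈ A, toRouting.OnDart a r

namespace TeleportationProtocol

variable {N : QuantumTensorNetwork V} (P : TeleportationProtocol N)

/-- The protocol as an LOCC protocol. -/
noncomputable def toLOCC : LOCC P.toRouting.loc P.toRouting.regDim :=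
  P.prep.append P.toRouting.teleportAll

/-- The protocol perfectly transmits a `D`-dimensional system from `s` to `t`: its input registers
at `s`, and its output registers at `t`, form a `D`-dimensional system, and the channel from the
input to the output which it implements over the edge states of the network is the identity. -/
def Transmits [Fintype V] (D : ℕ) : Prop :=
  ∃ enc : Fin D ≃ ∀ i, Fin (P.dim i), ∀ τ : Matrix (Fin D) (Fin D) ℂ,
    P.toRouting.reduced enc (P.toLOCC.run (P.toRouting.initial enc τ)) = τ

end TeleportationProtocol

end QuantumTensorNetwork

/-! ### Local operations and classical communication: general facts -/

namespace LOCC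

open Matrix

variable {V : Type u} {R : Type w} [DecidableEq R] {loc : R → V} {dim : R → ℕ}

/-! Arithmetic part. For every prime `p`, the `p`-adic valuation of a strict flow is an additive
integral flow. If `p` divides the outflow of the source, then some path from source to sink has all
its flow values divisible by `p` (`IsSourceFlow.exists_isPath`). Dividing `p` out along this path
leaves a flow with smaller outflow, so induction yields paths of prime dimensions whose product is
the whole outflow (`IsSourceFlow.exists_routing`). Their loads divide the given flow values and
hence respect the capacities. What remains of the given flow may contain circulations, so the flow
in the conclusion is the one defined by the paths. A maximal strict flow exists, and the equality of
the maximal value with the min-cut makes the product of the primes equal to the min-cut.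

Quantum part. All hops along an edge, in both directions, together need a maximally entangled state
of rank `m`, the product of the two loads, and `m ≤ d`. The rank `d` state is converted with
certainty (`Distill.conveys_distill`). One end measures which of the `d` cyclic windows of length
`m` in `ℤ/d` the state lies in; each basis state is in exactly `m` windows, so the weights `1/√m`
give a complete measurement. The other end learns the window and follows. The result factors into
one pair per hop, and teleportation (`Teleport.conveys_teleport`) moves the systems along the
routes.

Correctness is proved backwards through the protocol with the predicate `Conveys`: the rest of the
protocol returns every input up to a scalar that does not depend on the input. This lets each
outcome be treated separately, with its normalization dropped and impossible outcomes trivial. At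
the end the scalar is found to be `1`, because all operations preserve the trace
(`protocol_transmits`). -/

theorem append_assoc (P Q S : LOCC loc dim) : (P.append Q).append S = P.append (Q.append S) := by
  induction P with
  | done => rfl
  | step v A hA O K hK next ih =>
    simp only [append]
    congr 1
    funext o
    exact ih o

@[simp] theorem done_append (Q : LOCC loc dim) : (done : LOCC loc dim).append Q = Q := rfl

@[simp] theorem seq_nil : seq ([] : List (LOCC loc dim)) = done := rfl

theorem seq_cons (P : LOCC loc dim) (L : List (LOCC loc dim)) :
    seq (P :: L) = P.append (seq L) := rfl

theorem seq_append (L₁ L₂ : List (LOCC loc dim)) :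
    seq (L₁ ++ L₂) = (seq L₁).append (seq L₂) := by
  induction L₁ with
  | nil => rfl
  | cons P L ih => rw [List.cons_append, seq_cons, seq_cons, ih, append_assoc]

theorem StepsOn.append {p : Finset R → Prop} {P Q : LOCC loc dim} (hP : P.StepsOn p)
    (hQ : Q.StepsOn p) : (P.append Q).StepsOn p := by
  induction P with
  | done => exact hQ
  | step v A hA O K hK next ih => exact ⟨hP.1, fun o => ih o (hP.2 o)⟩

theorem StepsOn.seq {p : Finset R → Prop} {L : List (LOCC loc dim)}
    (h : ∀ P ∈ L, P.StepsOn p) : (seq L).StepsOn p := by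
  induction L with
  | nil => trivial
  | cons P L ih =>
    rw [seq_cons]
    exact (h P (by simp)).append (ih fun Q hQ => h Q (by simp [hQ]))

/-- Replace the part of a configuration on the registers in `A`. -/
def overwrite (A : Finset R) (x : ∀ r, Fin (dim r)) (z : ∀ r : A, Fin (dim r)) :
    ∀ r, Fin (dim r) :=
  fun r => if h : r ∈ A then z ⟨r, h⟩ else x r

@[simp] theorem overwrite_coe (A : Finset R) (x : ∀ r, Fin (dim r)) (z : ∀ r : A, Fin (dim r))
    (r : A) : overwrite A x z r = z r := by
  simp [overwrite]

theorem overwrite_of_notMem {A : Finset R} (x : ∀ r, Fin (dim r)) (z : ∀ r : A, Fin (dim r))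
    {r : R} (h : r ∉ A) : overwrite A x z r = x r := by
  simp [overwrite, h]

theorem dependsOn_overwrite {β : Type*} {F : (∀ r, Fin (dim r)) → β} {A : Finset R} {S : Set R}
    (hF : DependsOn F S) (hS : Disjoint S (A : Set R)) (x : ∀ r, Fin (dim r))
    (z : ∀ r : A, Fin (dim r)) : F (overwrite A x z) = F x :=
  hF fun _ hr => overwrite_of_notMem x z fun hA => Set.disjoint_left.mp hS hr hA

/-! ### Operators acting on part of the registers. -/

variable [Fintype R]

/-- A row of `lift A K` is supported on the configurations that agree with `x` off `A`; these are
exactly the overwritings of `x`, one for each state of `A`. -/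
theorem lift_mul_apply {I : Type*} (A : Finset R)
    (K : Matrix (∀ r : A, Fin (dim r)) (∀ r : A, Fin (dim r)) ℂ)
    (M : Matrix (∀ r, Fin (dim r)) I ℂ) (x : ∀ r, Fin (dim r)) (i : I) :
    (lift A K * M) x i = ∑ z, K (fun r => x r) z * M (overwrite A x z) i := by
  rw [Matrix.mul_apply]
  symm
  refine Finset.sum_of_injOn (overwrite A x) ?_ (fun _ _ => by simp) ?_ ?_
  · intro z _ z' _ h
    funext r
    simpa using congrFun h r
  · intro y _ hy
    rw [lift, if_neg, zero_mul]
    intro h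
    refine hy ⟨fun r => y r, by simp, ?_⟩
    funext r
    by_cases hr : r ∈ A
    · simp [overwrite, hr]
    · simp [overwrite, hr, h r hr]
  · intro z _
    rw [lift, if_pos]
    · simp
    · intro r hr
      rw [overwrite_of_notMem _ _ hr]

/-- Splitting configurations into their parts on and off `A` exhibits the lift as a Kronecker
product with an identity, so that its algebra is inherited from that of Kronecker products. -/
theorem lift_eq_submatrix (A : Finset R)
    (K : Matrix (∀ r : A, Fin (dim r)) (∀ r : A, Fin (dim r)) ℂ) :
    lift A K = (kroneckerMap (· * ·) K
      (1 : Matrix (∀ r : {r // r ∉ A}, Fin (dim r)) (∀ r : {r // r ∉ A}, Fin (dim r)) ℂ)).submatrix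
      (Equiv.piEquivPiSubtypeProd (· ∈ A) fun r => Fin (dim r))
      (Equiv.piEquivPiSubtypeProd (· ∈ A) fun r => Fin (dim r)) := by
  ext x y
  simp only [lift, submatrix_apply, kroneckerMap_apply, Equiv.piEquivPiSubtypeProd_apply,
    Matrix.one_apply, mul_ite, mul_one, mul_zero, funext_iff, Subtype.forall]
  congr

theorem lift_conjTranspose_mul_lift (A : Finset R)
    (K : Matrix (∀ r : A, Fin (dim r)) (∀ r : A, Fin (dim r)) ℂ) :
    (lift A K)ᴴ * lift A K = lift A (Kᴴ * K) := by
  simp only [lift_eq_submatrix, conjTranspose_submatrix, submatrix_mul_equiv]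
  congr 1
  rw [conjTranspose_kronecker, ← mul_kronecker_mul]
  simp

theorem lift_one (A : Finset R) :
    lift (dim := dim) A 1 = 1 := by
  rw [lift_eq_submatrix, one_kronecker_one, submatrix_one_equiv]

theorem lift_sum {O : Type*} (A : Finset R) (s : Finset O)
    (K : O → Matrix (∀ r : A, Fin (dim r)) (∀ r : A, Fin (dim r)) ℂ) :
    lift A (∑ o ∈ s, K o) = ∑ o ∈ s, lift A (K o) := by
  ext x y
  simp only [lift, Matrix.sum_apply]
  split_ifs <;> simp

/-- Protocols preserve the trace. -/
theorem trace_run (P : LOCC loc dim) (σ : Matrix (∀ r, Fin (dim r)) (∀ r, Fin (dim r)) ℂ) :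
    (P.run σ).trace = σ.trace := by
  induction P generalizing σ with
  | done => rfl
  | step v A hA O K hK next ih =>
    simp only [run, trace_sum, ih]
    have : ∀ o, (lift A (K o) * σ * (lift A (K o))ᴴ).trace =
        (lift A ((K o)ᴴ * K o) * σ).trace := by
      intro o
      rw [trace_mul_comm, ← Matrix.mul_assoc, lift_conjTranspose_mul_lift]
    simp only [this]
    rw [← trace_sum, ← Finset.sum_mul, ← lift_sum, hK, lift_one, Matrix.one_mul]

theorem run_smul (P : LOCC loc dim) (c : ℂ)
    (σ : Matrix (∀ r, Fin (dim r)) (∀ r, Fin (dim r)) ℂ) : P.run (c • σ) = c • P.run σ := by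
  induction P generalizing σ with
  | done => rfl
  | step v A hA O K hK next ih =>
    simp only [run, Finset.smul_sum, ← ih, Matrix.mul_smul, Matrix.smul_mul]

/-! ### Backward reasoning about protocols. -/

/-- When the columns of `M` are the states belonging to the basis states of an input system, then
the protocol `P`, followed by `out`, recovers every state of that system up to a common factor. -/
def Conveys {I : Type*} [Fintype I]
    (out : Matrix (∀ r, Fin (dim r)) (∀ r, Fin (dim r)) ℂ →ₗ[ℂ] Matrix I I ℂ)
    (P : LOCC loc dim) (M : Matrix (∀ r, Fin (dim r)) I ℂ) : Prop :=
  ∃ w : ℂ, ∀ τ : Matrix I I ℂ, out (P.run (M * τ * Mᴴ)) = w • τ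

variable {I : Type*} [Fintype I]
  {out : Matrix (∀ r, Fin (dim r)) (∀ r, Fin (dim r)) ℂ →ₗ[ℂ] Matrix I I ℂ}

/-- The factor only rescales `w` by `c * star c`; this is what allows normalizations of states to be
ignored. -/
theorem Conveys.smul {P : LOCC loc dim} {M : Matrix (∀ r, Fin (dim r)) I ℂ}
    (h : Conveys out P M) (c : ℂ) : Conveys out P (c • M) := by
  obtain ⟨w, hw⟩ := h
  refine ⟨c * star c * w, fun τ => ?_⟩
  have : (c • M) * τ * (c • M)ᴴ = (c * star c) • (M * τ * Mᴴ) := by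
    rw [conjTranspose_smul, Matrix.smul_mul, Matrix.smul_mul, Matrix.mul_smul, smul_smul]
  rw [this, run_smul, map_smul, hw, smul_smul]

/-- Disposes of measurement outcomes of amplitude zero, whatever the protocol does after them. -/
theorem conveys_zero (P : LOCC loc dim) : Conveys out P 0 := by
  refine ⟨0, fun τ => ?_⟩
  have := run_smul P 0 0
  rw [zero_smul, zero_smul] at this
  simp [this]

/-- Both the run and `out` are additive over outcomes, so the scalars of the branches add up. They
may differ between outcomes; it matters only that none depends on the input. -/
theorem conveys_step_append {v : V} {A : Finset R} {hA : ∀ r ∈ A, loc r = v} {O : Type}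
    [Fintype O] {K : O → Matrix (∀ r : A, Fin (dim r)) (∀ r : A, Fin (dim r)) ℂ}
    {hK : ∑ o, (K o).conjTranspose * K o = 1} {next : O → LOCC loc dim} {Q : LOCC loc dim}
    {M : Matrix (∀ r, Fin (dim r)) I ℂ}
    (h : ∀ o, Conveys out ((next o).append Q) (lift A (K o) * M)) :
    Conveys out ((step v A hA O K hK next).append Q) M := by
  choose w hw using h
  refine ⟨∑ o, w o, fun τ => ?_⟩
  simp only [append, run, map_sum, Finset.sum_smul]
  refine Finset.sum_congr rfl fun o _ => ?_
  rw [← hw o τ, conjTranspose_mul]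
  simp only [Matrix.mul_assoc]

/-- The matrix whose columns are the states `ψ · i`. -/
abbrev columns {R : Type w} (dim : R → ℕ) {I : Type*} (ψ : (∀ r, Fin (dim r)) → I → ℂ) :
    Matrix (∀ r, Fin (dim r)) I ℂ :=
  Matrix.of ψ

theorem Conveys.congr {P : LOCC loc dim} {ψ φ : (∀ r, Fin (dim r)) → I → ℂ}
    (h : Conveys out P (columns dim ψ)) (e : ∀ x i, ψ x i = φ x i) :
    Conveys out P (columns dim φ) := by
  rwa [← show ψ = φ from funext fun x => funext fun i => e x i]

end LOCC

/-! ### Concentration of entanglement -/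

namespace Distill

open Matrix LOCC

/-- The isometry which maps the basis vector `h` to the basis vector `α h`. -/
def basisMap {X H : Type*} [DecidableEq X] (α : H → X) : Matrix X H ℂ :=
  Matrix.of fun x h => if x = α h then 1 else 0

section

variable {X H H' : Type*} [DecidableEq X] [Fintype X]

theorem basisMap_conjTranspose_mul (α : H → X) (β : H' → X) :
    (basisMap α)ᴴ * basisMap β = Matrix.of fun h n => if α h = β n then (1 : ℂ) else 0 := by
  ext h n
  simp [basisMap, Matrix.mul_apply, eq_comm]

theorem basisMap_isometry [DecidableEq H] {α : H → X} (hα : Function.Injective α) :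
    (basisMap α)ᴴ * basisMap α = 1 := by
  rw [basisMap_conjTranspose_mul]
  ext h n
  simp [Matrix.one_apply, hα.eq_iff]

variable [Fintype H] [DecidableEq H] {φ α : H → X}

/-- The isometry `basisMap φ` cancels, which leaves the projection onto the span of the states `α
h`. -/
theorem partialIsometry_conjTranspose_mul (hφ : Function.Injective φ) :
    (basisMap φ * (basisMap α)ᴴ)ᴴ * (basisMap φ * (basisMap α)ᴴ) =
      basisMap α * (basisMap α)ᴴ := by
  rw [conjTranspose_mul, conjTranspose_conjTranspose, Matrix.mul_assoc, ← Matrix.mul_assoc _ᴴ,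
    basisMap_isometry hφ, Matrix.one_mul]

theorem complement_conjTranspose_mul (hα : Function.Injective α) :
    (1 - basisMap α * (basisMap α)ᴴ)ᴴ * (1 - basisMap α * (basisMap α)ᴴ) =
      1 - basisMap α * (basisMap α)ᴴ := by
  have h : basisMap α * (basisMap α)ᴴ * (basisMap α * (basisMap α)ᴴ) =
      basisMap α * (basisMap α)ᴴ := by
    rw [Matrix.mul_assoc, ← Matrix.mul_assoc _ᴴ, basisMap_isometry hα, Matrix.one_mul]
  rw [conjTranspose_sub, conjTranspose_one, conjTranspose_mul, conjTranspose_conjTranspose,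
    Matrix.sub_mul, Matrix.mul_sub, Matrix.mul_sub, h]
  simp

omit [Fintype X] [DecidableEq H] in
-- For fixed `h` the map `o ↦ κ h + o` permutes `Fin d`, so each `h` contributes the full projection
-- once: the cyclic windows cover every state `card H` times.
theorem sum_basisMap_shift {d : ℕ} [NeZero d] {ι : Fin d → X} (κ : H → Fin d) :
    ∑ o : Fin d, basisMap (fun h => ι (κ h + o)) * (basisMap fun h => ι (κ h + o))ᴴ =
      (Fintype.card H : ℂ) • (basisMap ι * (basisMap ι)ᴴ) := by
  ext x y
  simp only [Matrix.sum_apply, Matrix.mul_apply, conjTranspose_apply, Matrix.smul_apply]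
  rw [Finset.sum_comm]
  have : ∀ h : H, ∑ o : Fin d, basisMap (fun h => ι (κ h + o)) x h *
      star (basisMap (fun h => ι (κ h + o)) y h) =
      ∑ n : Fin d, basisMap ι x n * star (basisMap ι y n) := fun h =>
    Fintype.sum_equiv (Equiv.addLeft (κ h)) _ _ fun o => rfl
  rw [Finset.sum_congr rfl fun h _ => this h]
  simp

end

variable {V : Type u} {R : Type w} [DecidableEq R] {loc : R → V} {dim : R → ℕ}
  {H : Type*} [Fintype H] [DecidableEq H]

/-- The measurement which projects onto a window of `card H` out of the `d` states `ι n`, and maps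
the states of that window to the states `φ h`. -/
noncomputable def windowKraus {X : Type*} [DecidableEq X] [Fintype X] {d : ℕ} [NeZero d]
    (κ : H → Fin d) (φ : H → X) (ι : Fin d → X) : Option (Fin d) → Matrix X X ℂ
  | none => 1 - basisMap ι * (basisMap ι)ᴴ
  | some o => ((Real.sqrt (Fintype.card H) : ℝ) : ℂ)⁻¹ •
      (basisMap φ * (basisMap fun h => ι (κ h + o))ᴴ)

/-- The squared weight `1 / card H` compensates for the multiplicity of the covering by windows, and
the outcome `none` supplies the complement of the span of `ι`. -/
theorem windowKraus_complete {X : Type*} [DecidableEq X] [Fintype X] {d : ℕ} [NeZero d] [Nonempty H]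
    (κ : H → Fin d) {φ : H → X} {ι : Fin d → X} (hφ : Function.Injective φ)
    (hι : Function.Injective ι) :
    ∑ o, (windowKraus κ φ ι o)ᴴ * windowKraus κ φ ι o = 1 := by
  have hc : ((Fintype.card H : ℕ) : ℂ) ≠ 0 := by
    exact_mod_cast Fintype.card_ne_zero
  have hs : ((Real.sqrt (Fintype.card H) : ℝ) : ℂ) * ((Real.sqrt (Fintype.card H) : ℝ) : ℂ) =
      Fintype.card H := by
    rw [← Complex.ofReal_mul, Real.mul_self_sqrt (Nat.cast_nonneg _)]; simp
  have h1 : ∀ o, (windowKraus κ φ ι (some o))ᴴ * windowKraus κ φ ι (some o) =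
      (Fintype.card H : ℂ)⁻¹ •
        (basisMap (fun h => ι (κ h + o)) * (basisMap fun h => ι (κ h + o))ᴴ) := by
    intro o
    rw [windowKraus, conjTranspose_smul, Matrix.smul_mul, Matrix.mul_smul, smul_smul,
      partialIsometry_conjTranspose_mul hφ]
    congr 1
    rw [← hs, star_inv₀, RCLike.star_def, Complex.conj_ofReal, mul_inv]
  rw [Fintype.sum_option]
  simp only [h1]
  rw [← Finset.smul_sum, sum_basisMap_shift, smul_smul, inv_mul_cancel₀ hc, one_smul, windowKraus,
    complement_conjTranspose_mul hι, sub_add_cancel]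

/-- The operation which maps the states `α h` to the states `φ h`; the other outcome of the
corresponding measurement is that the state is orthogonal to all `α h`. -/
noncomputable def followKraus {X : Type*} [DecidableEq X] [Fintype X] (φ α : H → X) :
    Bool → Matrix X X ℂ
  | false => 1 - basisMap α * (basisMap α)ᴴ
  | true => basisMap φ * (basisMap α)ᴴ

theorem followKraus_complete {X : Type*} [DecidableEq X] [Fintype X] {φ α : H → X}
    (hφ : Function.Injective φ) (hα : Function.Injective α) :
    ∑ o, (followKraus φ α o)ᴴ * followKraus φ α o = 1 := by
  rw [Fintype.sum_bool, followKraus, followKraus, partialIsometry_conjTranspose_mul hφ,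
    complement_conjTranspose_mul hα, add_sub_cancel]

omit [Fintype H] [DecidableEq H] in
theorem shift_injective {X : Type*} {d : ℕ} [NeZero d] {κ : H → Fin d} {ι : Fin d → X}
    (hκ : Function.Injective κ) (hι : Function.Injective ι) (o : Fin d) :
    Function.Injective fun h => ι (κ h + o) :=
  fun _ _ h => hκ (add_right_cancel (hι h))

/-- Two vertices, which share the maximally entangled state `∑ n, |ιA n⟩ |ιB n⟩` of rank `d`,
turn it into the maximally entangled state `∑ h, |φA h⟩ |φB h⟩` of rank `card H ≤ d`. -/
noncomputable def distill (u v : V) (A B : Finset R) (hA : ∀ r ∈ A, loc r = u)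
    (hB : ∀ r ∈ B, loc r = v) {d : ℕ} [NeZero d] [Nonempty H] (κ : H → Fin d)
    (hκ : Function.Injective κ)
    (φA : H → ∀ r : A, Fin (dim r)) (ιA : Fin d → ∀ r : A, Fin (dim r))
    (φB : H → ∀ r : B, Fin (dim r)) (ιB : Fin d → ∀ r : B, Fin (dim r))
    (hφA : Function.Injective φA) (hιA : Function.Injective ιA)
    (hφB : Function.Injective φB) (hιB : Function.Injective ιB) : LOCC loc dim :=
  .step u A hA (Option (Fin d)) (windowKraus κ φA ιA) (windowKraus_complete κ hφA hιA) fun o =>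
    match o with
    | none => .done
    | some o => .step v B hB Bool (followKraus φB fun h => ιB (κ h + o))
        (followKraus_complete hφB (shift_injective hκ hιB o)) fun _ => .done

section

variable [Fintype R] {I : Type*} {A : Finset R} {N : Type*} [Fintype N] [DecidableEq N]
  {α : N → ∀ r : A, Fin (dim r)} {G : (∀ r, Fin (dim r)) → I → N → ℂ}

omit [DecidableEq N] in
-- Since `G` ignores the registers in `A`, overwriting them does not change it, and `K` acts on the
-- `A`-factor alone.
theorem lift_mul_basisMap (hG : ∀ i n, DependsOn (fun x => G x i n) ((A : Set R)ᶜ))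
    (K : Matrix (∀ r : A, Fin (dim r)) (∀ r : A, Fin (dim r)) ℂ) :
    lift A K * (Matrix.of fun x i => ∑ n, basisMap α (fun r : A => x r) n * G x i n) =
      Matrix.of fun x i => ∑ n, (K * basisMap α) (fun r : A => x r) n * G x i n := by
  ext x i
  rw [lift_mul_apply]
  simp only [Matrix.of_apply, overwrite_coe]
  have hG' : ∀ z n, G (overwrite A x z) i n = G x i n := fun z n =>
    dependsOn_overwrite (hG i n) disjoint_compl_left x z
  simp only [hG', Finset.mul_sum, Matrix.mul_apply, Finset.sum_mul, ← mul_assoc]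
  exact Finset.sum_comm

omit [DecidableEq H] in
-- The states `α n` are orthonormal, so of the sum over `n` only the terms `n = f h` survive. With
-- `f` a cyclic shift this cuts out a window.
theorem lift_partialIsometry_mul (hα : Function.Injective α)
    (hG : ∀ i n, DependsOn (fun x => G x i n) ((A : Set R)ᶜ)) (φ : H → ∀ r : A, Fin (dim r))
    (f : H → N) :
    lift A (basisMap φ * (basisMap fun h => α (f h))ᴴ) *
      (columns dim fun x i => ∑ n, basisMap α (fun r : A => x r) n * G x i n) =
      columns dim fun x i => ∑ h, basisMap φ (fun r : A => x r) h * G x i (f h) := by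
  rw [lift_mul_basisMap hG, Matrix.mul_assoc, basisMap_conjTranspose_mul]
  ext x i
  simp only [Matrix.mul_apply, Matrix.of_apply, hα.eq_iff, Finset.sum_mul]
  rw [Finset.sum_comm]
  simp [ite_mul]

theorem lift_complement_mul (hα : Function.Injective α)
    (hG : ∀ i n, DependsOn (fun x => G x i n) ((A : Set R)ᶜ)) :
    lift A (1 - basisMap α * (basisMap α)ᴴ) *
      (columns dim fun x i => ∑ n, basisMap α (fun r : A => x r) n * G x i n) = 0 := by
  rw [lift_mul_basisMap hG, Matrix.sub_mul, Matrix.mul_assoc, basisMap_isometry hα]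
  ext x i
  simp

end

/-- Window `o` leaves `∑ h, |φA h⟩ |ιB (κ h + o)⟩` up to a scalar. The second party knows `o` and
renames the states `ιB (κ h + o)` to `φB h`. The remaining factor `χ` is untouched because it
ignores both sets of registers. -/
theorem conveys_distill [Fintype R] {I : Type*} [Fintype I]
    {out : Matrix (∀ r, Fin (dim r)) (∀ r, Fin (dim r)) ℂ →ₗ[ℂ] Matrix I I ℂ}
    (u v : V) {A B : Finset R} (hA : ∀ r ∈ A, loc r = u)
    (hB : ∀ r ∈ B, loc r = v) (hAB : Disjoint A B) {d : ℕ} [NeZero d] [Nonempty H] {κ : H → Fin d}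
    (hκ : Function.Injective κ)
    {φA : H → ∀ r : A, Fin (dim r)} {ιA : Fin d → ∀ r : A, Fin (dim r)}
    {φB : H → ∀ r : B, Fin (dim r)} {ιB : Fin d → ∀ r : B, Fin (dim r)}
    (hφA : Function.Injective φA) (hιA : Function.Injective ιA)
    (hφB : Function.Injective φB) (hιB : Function.Injective ιB)
    {χ : (∀ r, Fin (dim r)) → I → ℂ}
    (hχ : ∀ i, DependsOn (fun x => χ x i) (((A ∪ B : Finset R) : Set R)ᶜ)) {Q : LOCC loc dim}
    (h : Conveys out Q (columns dim fun x i => ∑ h, χ x i * (basisMap φA (fun r : A => x r) h *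
      basisMap φB (fun r : B => x r) h))) :
    Conveys out ((distill u v A B hA hB κ hκ φA ιA φB ιB hφA hιA hφB hιB).append Q)
      (columns dim fun x i => ∑ n, χ x i * (basisMap ιA (fun r : A => x r) n *
        basisMap ιB (fun r : B => x r) n)) := by
  have hdepA : ∀ i, DependsOn (fun x => χ x i) ((A : Set R)ᶜ) := fun i x y hxy =>
    hχ i fun r hr => hxy r (by simp at hr; simp [hr])
  have hdepB : ∀ i, DependsOn (fun x => χ x i) ((B : Set R)ᶜ) := fun i x y hxy =>
    hχ i fun r hr => hxy r (by simp at hr; simp [hr])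
  have hG1 : ∀ i n, DependsOn (fun x => χ x i * basisMap ιB (fun r : B => x r) n)
      ((A : Set R)ᶜ) := by
    intro i n x y hxy
    have h1 : χ x i = χ y i := hdepA i hxy
    have h2 : (fun r : B => x r) = fun r : B => y r := by
      funext r
      exact hxy r fun hr => Finset.disjoint_left.mp hAB hr r.2
    simp only [h1, h2]
  have hG2 : ∀ i h, DependsOn (fun x => χ x i * basisMap φA (fun r : A => x r) h)
      ((B : Set R)ᶜ) := by
    intro i n x y hxy
    have h1 : χ x i = χ y i := hdepB i hxy
    have h2 : (fun r : A => x r) = fun r : A => y r := by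
      funext r
      exact hxy r fun hr => Finset.disjoint_left.mp hAB r.2 hr
    simp only [h1, h2]
  have e1 : (columns dim fun x i => ∑ n, χ x i * (basisMap ιA (fun r : A => x r) n *
        basisMap ιB (fun r : B => x r) n)) = columns dim fun (x : ∀ r, Fin (dim r)) i =>
        ∑ n, basisMap ιA (fun r : A => x r) n * (χ x i * basisMap ιB (fun r : B => x r) n) := by
    ext x i
    simp only [Matrix.of_apply]
    exact Finset.sum_congr rfl fun n _ => by ring
  rw [e1]
  refine conveys_step_append fun o => ?_
  rcases o with _ | o
  -- The state lies in the span of `ιA` on `A`, so this outcome has amplitude zero.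
  · rw [windowKraus, lift_complement_mul hιA hG1]
    exact conveys_zero _
  · have hl : ∀ (c : ℂ) (K : Matrix (∀ r : A, Fin (dim r)) (∀ r : A, Fin (dim r)) ℂ),
        lift A (c • K) = c • lift A K := by
      intro c K
      ext x y
      simp [lift]
    rw [windowKraus, hl, Matrix.smul_mul,
      lift_partialIsometry_mul hιA hG1 φA fun h => κ h + o]
    refine Conveys.smul ?_ _
    -- The same sum, now regrouped as an expansion along `B`.
    have e2 : (columns dim fun (x : ∀ r, Fin (dim r)) i => ∑ h, basisMap φA (fun r : A => x r) h *
        (χ x i * basisMap ιB (fun r : B => x r) (κ h + o))) =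
        columns dim fun (x : ∀ r, Fin (dim r)) i =>
          ∑ h, basisMap (fun h => ιB (κ h + o)) (fun r : B => x r) h *
            (χ x i * basisMap φA (fun r : A => x r) h) := by
      ext x i
      simp only [Matrix.of_apply]
      refine Finset.sum_congr rfl fun n _ => ?_
      simp only [basisMap, Matrix.of_apply]
      ring
    rw [e2]
    refine conveys_step_append fun o' => ?_
    have hinj := shift_injective hκ hιB o
    rcases o' with _ | _
    · rw [followKraus, lift_complement_mul hinj hG2]
      exact conveys_zero _
    · rw [followKraus, lift_partialIsometry_mul hinj hG2 φB fun h => h]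
      refine h.congr fun x i => ?_
      exact Finset.sum_congr rfl fun n _ => by ring

end Distill

/-! ### The effect of one teleportation -/

namespace Teleport

open Matrix LOCC

variable {V : Type u} {R : Type w} [DecidableEq R] {loc : R → V} {dim : R → ℕ}

/-- States of a single `p`-dimensional register. -/
def singleEquiv {p : ℕ} {c : R} (hc : dim c = p) :
    (∀ r : ({c} : Finset R), Fin (dim r)) ≃ Fin p where
  toFun x := Fin.cast hc (x ⟨c, by simp⟩)
  invFun z r := Fin.cast (by rw [Finset.mem_singleton.mp r.2, hc]) z
  left_inv x := by
    funext r
    obtain ⟨r, hr⟩ := r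
    have hr' := hr
    rw [Finset.mem_singleton] at hr'
    subst hr'
    rfl
  right_inv z := rfl

/-- Only `z = y + k mod p` contributes. If `y = v`, the phases are conjugate and cancel; otherwise
the Bell coordinate vanishes because shifting is injective. -/
theorem sum_correction_mul_bell {p j k v y : ℕ} (hv : v < p) (hy : y < p) :
    ∑ z : Fin p, correction p j k y z * (starRingEnd ℂ) (bell p j k v z) =
      ((Real.sqrt p : ℝ) : ℂ)⁻¹ * if y = v then 1 else 0 := by
  have hp : 0 < p := by omega
  rw [Finset.sum_eq_single ⟨(y + k) % p, Nat.mod_lt _ hp⟩]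
  · rw [correction, if_pos rfl, bell]
    by_cases h : y = v
    · subst h
      rw [if_pos rfl, if_pos rfl, map_div₀, Complex.conj_ofReal, ← mul_div_assoc, omega_pow_conj]
      simp
    · rw [if_neg h, if_neg]
      · simp
      · exact fun h' => h (shift_unique hv hy h').symm
  · intro z _ hz
    rw [correction, if_neg, zero_mul]
    exact fun h => hz (Fin.ext h.symm)
  · simp

variable [Fintype R] {I : Type*}

/-- For a fixed state of `c`, the pair condition and the message leave a single basis state of `a`,
`b`, so the inner product with the Bell vector is one coordinate of it. The measured registers end
up in the Bell vector itself. -/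
theorem lift_bellProj_mul {p j k : ℕ} {a b c : R} (hab : a ≠ b) (hac : a ≠ c) (hbc : b ≠ c)
    (da : dim a = p) (db : dim b = p) (dc : dim c = p)
    {χ : (∀ r, Fin (dim r)) → I → ℂ} (hχ : ∀ i, DependsOn (fun x => χ x i) ({a, b, c} : Set R)ᶜ)
    {v : I → ℕ} (hv : ∀ i, v i < p) :
    lift (dim := dim) {a, b} (bellProj p j k a b) * (columns dim fun x i =>
      χ x i * if (x a : ℕ) = v i ∧ (x b : ℕ) = x c then 1 else 0) =
      (columns dim fun x i => χ x i * bell p j k (x a) (x b) *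
        (starRingEnd ℂ) (bell p j k (v i) (x c))) := by
  ext x i
  rw [lift_mul_apply]
  have h1 : ∀ z, χ (overwrite {a, b} x z) i = χ x i := fun z =>
    dependsOn_overwrite (hχ i) (by
      rw [Set.disjoint_compl_left_iff_subset]
      intro r; simp; tauto) x z
  have h2 : ∀ z, overwrite {a, b} x z c = x c := fun z =>
    overwrite_of_notMem _ _ (by simp [hac.symm, hbc.symm])
  have h3 : ∀ z, overwrite {a, b} x z a = z ⟨a, by simp⟩ := fun z =>
    overwrite_coe {a, b} x z ⟨a, by simp⟩
  have h4 : ∀ z, overwrite {a, b} x z b = z ⟨b, by simp⟩ := fun z =>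
    overwrite_coe {a, b} x z ⟨b, by simp⟩
  simp only [Matrix.of_apply, h1, h2, h3, h4, bellProj]
  refine (Fintype.sum_equiv (pairEquiv hab da db) _ (fun z => bell p j k (x a) (x b) *
    (starRingEnd ℂ) (bell p j k z.1 z.2) *
      (χ x i * if (z.1 : ℕ) = v i ∧ (z.2 : ℕ) = x c then 1 else 0)) fun z => rfl).trans ?_
  rw [Finset.sum_eq_single (⟨v i, hv i⟩, Fin.cast dc (x c))]
  · simp only [Fin.val_cast, and_self, if_true]
    ring
  · intro z _ hz
    rw [if_neg]
    · simp
    · rintro ⟨h, h'⟩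
      exact hz (Prod.ext (Fin.ext h) (Fin.ext h'))
  · simp

theorem lift_corrOp_mul {p j k : ℕ} {c : R} (dc : dim c = p)
    {χ : (∀ r, Fin (dim r)) → I → ℂ} (hχ : ∀ i, DependsOn (fun x => χ x i) ({c} : Set R)ᶜ)
    {v : I → ℕ} (hv : ∀ i, v i < p) :
    lift (dim := dim) {c} (corrOp p j k c) * (columns dim fun x i =>
      χ x i * (starRingEnd ℂ) (bell p j k (v i) (x c))) =
      ((Real.sqrt p : ℝ) : ℂ)⁻¹ •
        (columns dim fun x i => χ x i * if (x c : ℕ) = v i then 1 else 0) := by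
  ext x i
  rw [lift_mul_apply]
  have h1 : ∀ z, χ (overwrite {c} x z) i = χ x i := fun z =>
    dependsOn_overwrite (hχ i) (by simp) x z
  have h3 : ∀ z, overwrite {c} x z c = z ⟨c, by simp⟩ := fun z =>
    overwrite_coe {c} x z ⟨c, by simp⟩
  simp only [Matrix.of_apply, h1, h3, corrOp, Matrix.smul_apply, smul_eq_mul]
  refine (Fintype.sum_equiv (singleEquiv dc) _ (fun z => correction p j k (x c) z *
    (χ x i * (starRingEnd ℂ) (bell p j k (v i) z))) fun z => rfl).trans ?_
  have := sum_correction_mul_bell (j := j) (k := k) (hv i) (dc ▸ (x c).2 : (x c : ℕ) < p)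
  calc _ = χ x i * ∑ z : Fin p, correction p j k (x c) z *
        (starRingEnd ℂ) (bell p j k (v i) z) := by
        rw [Finset.mul_sum]
        exact Finset.sum_congr rfl fun z _ => by ring
    _ = _ := by rw [this]; ring

/-- After the correction `c` carries the message, while `a`, `b` hold a Bell vector that depends on
the outcome but not on the message. Hence nothing about the input leaks, and the factor `1/√p` is
absorbed by `Conveys.smul`. -/
theorem conveys_teleport [Fintype I]
    {out : Matrix (∀ r, Fin (dim r)) (∀ r, Fin (dim r)) ℂ →ₗ[ℂ] Matrix I I ℂ}
    {p : ℕ} {u u' : V} {a b c : R} (hab : a ≠ b) (hac : a ≠ c) (hbc : b ≠ c)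
    (ha : loc a = u) (hb : loc b = u) (hc : loc c = u')
    (da : dim a = p) (db : dim b = p) (dc : dim c = p) (hp : p ≠ 0)
    {χ : (∀ r, Fin (dim r)) → I → ℂ} (hχ : ∀ i, DependsOn (fun x => χ x i) ({a, b, c} : Set R)ᶜ)
    {v : I → ℕ} (hv : ∀ i, v i < p) {Q : LOCC loc dim}
    (h : ∀ j k, Conveys out Q (columns dim fun x i => χ x i * bell p j k (x a) (x b) *
      if (x c : ℕ) = v i then 1 else 0)) :
    Conveys out ((teleport p u u' a b c hab ha hb hc da db dc hp).append Q) (columns dim fun x i =>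
      χ x i * if (x a : ℕ) = v i ∧ (x b : ℕ) = x c then 1 else 0) := by
  refine conveys_step_append fun o => ?_
  rw [lift_bellProj_mul hab hac hbc da db dc hχ hv]
  refine conveys_step_append fun _ => ?_
  rw [lift_corrOp_mul (χ := fun x i => χ x i * bell p o.1 o.2 (x a) (x b)) dc ?_ hv]
  · exact (h o.1 o.2).smul _
  · intro i x y hxy
    have h1 : χ x i = χ y i := hχ i fun r hr => hxy r (by simp at hr; simp [hr])
    have h2 : x a = y a := hxy a (by simpa using hac)
    have h3 : x b = y b := hxy b (by simpa using hbc)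
    simp only [h1, h2, h3]

end Teleport

/-! ### The hops of a routing -/

namespace QuantumTensorNetwork

variable {V : Type u} {N : QuantumTensorNetwork V}

instance neZero_d_edge (a : N.graph.Dart) : NeZero (N.d a.edge) :=
  ⟨by have := N.two_le_d _ a.edge_mem; omega⟩

namespace Routing

variable (ρ : Routing N)

/-- The hops of all routes. -/
abbrev Hop : Type := Σ i : Fin ρ.n, Fin (ρ.route i).length

/-- The directed edge along which a hop goes. -/
def hopDart (h : ρ.Hop) : N.graph.Dart :=
  ⟨((ρ.route h.1).getVert h.2, (ρ.route h.1).getVert (h.2 + 1)),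
    (ρ.route h.1).adj_getVert_succ h.2.2⟩

variable {ρ}

@[elab_as_elim]
-- Separates the input registers, which belong to no edge, from the receiving halves of pairs.
theorem Reg.cases_hop {motive : ρ.Reg → Prop} (edge : ∀ a, motive (.edge a))
    (input : ∀ i, motive (.msg i 0)) (receiver : ∀ i j, motive (.msg i (Fin.succ j)))
    (sender : ∀ i j, motive (.anc i j)) (r : ρ.Reg) : motive r := by
  rcases r with a | ⟨i, k⟩ | ⟨i, k⟩
  · exact edge a
  · induction k using Fin.cases with
    | zero => exact input i
    | succ j => exact receiver i j
  · exact sender i k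

theorem onDart_edge {a b : N.graph.Dart} : ρ.OnDart a (.edge b) ↔ b = a := Iff.rfl

theorem onDart_anc {a : N.graph.Dart} {i : Fin ρ.n} {j : Fin (ρ.route i).length} :
    ρ.OnDart a (.anc i j) ↔ ρ.hopDart ⟨i, j⟩ = a := by
  rw [SimpleGraph.Dart.ext_iff, Prod.ext_iff]
  simp only [OnDart, hopDart]
  exact and_congr eq_comm eq_comm

/-- The receiving half lies at the far end of the hop, whence the reversed direction. -/
theorem onDart_msg_succ {a : N.graph.Dart} {i : Fin ρ.n} {j : Fin (ρ.route i).length} :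
    ρ.OnDart a (.msg i j.succ) ↔ ρ.hopDart ⟨i, j⟩ = a.symm := by
  rw [SimpleGraph.Dart.ext_iff, Prod.ext_iff]
  simp only [OnDart, hopDart, Fin.succ_inj, SimpleGraph.Dart.symm_toProd, Prod.fst_swap,
    Prod.snd_swap]
  constructor
  · rintro ⟨j', rfl, h1, h2⟩
    exact ⟨h2.symm, h1.symm⟩
  · rintro ⟨h1, h2⟩
    exact ⟨j, rfl, h2.symm, h1.symm⟩

theorem not_onDart_input {a : N.graph.Dart} {i : Fin ρ.n} : ¬ ρ.OnDart a (.msg i 0) := by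
  rintro ⟨j, hj, _⟩
  exact Fin.succ_ne_zero j hj.symm

theorem loc_eq_of_onDart {a : N.graph.Dart} {r : ρ.Reg} (h : ρ.OnDart a r) : ρ.loc r = a.fst := by
  induction r using Reg.cases_hop with
  | edge b => rw [onDart_edge] at h; rw [h]; rfl
  | input i => exact absurd h not_onDart_input
  | receiver i j =>
    obtain ⟨j', hj, h1, _⟩ := h
    rw [h1, ← Fin.succ_injective _ hj]
    rfl
  | sender i j => exact h.1.symm

theorem eq_or_eq_symm_of_edge_eq {a b : N.graph.Dart} (h : b.edge = a.edge) :
    b = a ∨ b = a.symm :=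
  (SimpleGraph.dart_edge_eq_iff _ _).mp h

variable (ρ) in
open Classical in
-- Regroups the exponents as single hops, the form in which the load can be compared with the number
-- of joint states of the pairs.
theorem load_eq_prod_hop (a : N.graph.Dart) :
    ρ.load a = ∏ h : ρ.Hop, if ρ.hopDart h = a then ρ.dim h.1 else 1 := by
  rw [Fintype.prod_sigma, load]
  refine Finset.prod_congr rfl fun i _ => ?_
  have hd : (ρ.route i).darts = List.ofFn fun j : Fin (ρ.route i).length => ρ.hopDart ⟨i, j⟩ := by
    refine List.ext_getElem (by simp) fun n h1 h2 => ?_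
    rw [SimpleGraph.Walk.darts_getElem_eq_getVert, List.getElem_ofFn]
    rfl
  simp only [Finset.prod_ite, Finset.prod_const_one, mul_one, Finset.prod_const]
  congr 1
  rw [hd, ← Multiset.coe_count]
  have : (↑(List.ofFn fun j : Fin (ρ.route i).length => ρ.hopDart ⟨i, j⟩) : Multiset N.graph.Dart) =
      (Finset.univ.val.map fun j => ρ.hopDart ⟨i, j⟩) := by
    rw [Fin.univ_val_map]
  rw [this, Multiset.count_map, Finset.card_def, Finset.filter_val]
  simp only [eq_comm]

/-! ### The preparatory phase -/

variable (ρ)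

/-- Joint states of the pairs for the hops along an edge. -/
abbrev HopState (e : Sym2 V) : Type :=
  ∀ h : {h : ρ.Hop // (ρ.hopDart h).edge = e}, Fin (ρ.dim h.1.1)

instance (i : Fin ρ.n) : NeZero (ρ.dim i) := ⟨(ρ.dim_pos i).ne'⟩

open Classical in
noncomputable instance (e : Sym2 V) : Fintype (ρ.HopState e) := inferInstance

open Classical in
-- A hop along the edge goes in exactly one of the two directions, which are distinct.
theorem card_hopState (a : N.graph.Dart) :
    Fintype.card (ρ.HopState a.edge) = ρ.load a * ρ.load a.symm := by
  rw [load_eq_prod_hop, load_eq_prod_hop, ← Finset.prod_mul_distrib, Fintype.card_pi]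
  simp only [Fintype.card_fin]
  rw [← Finset.prod_subtype (Finset.univ.filter fun h : ρ.Hop => (ρ.hopDart h).edge = a.edge)
    (by simp) (fun h => ρ.dim h.1), Finset.prod_filter]
  refine Finset.prod_congr rfl fun h _ => ?_
  by_cases h1 : ρ.hopDart h = a
  · rw [if_pos (by rw [h1]), if_pos h1, if_neg (by rw [h1]; exact a.symm_ne.symm), mul_one]
  · by_cases h2 : ρ.hopDart h = a.symm
    · rw [if_pos (by rw [h2, SimpleGraph.Dart.edge_symm]), if_neg h1, if_pos h2, one_mul]
    · rw [if_neg (fun h3 => (eq_or_eq_symm_of_edge_eq h3).elim h1 h2), if_neg h1, if_neg h2, mul_one]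

open Classical in
/-- The configuration in which both halves of the state of the edge of `a` are in state `n`. -/
noncomputable def edgeConfig (a : N.graph.Dart) (n : Fin (N.d a.edge)) : ρ.Config
  | .edge b => if h : b.edge = a.edge then Fin.cast (congrArg N.d h.symm) n
      else (0 : Fin (N.d b.edge))
  | .msg i _ => (0 : Fin (ρ.dim i))
  | .anc i _ => (0 : Fin (ρ.dim i))

open Classical in
/-- The configuration in which both halves of the pair for the hop `h` are in state `g h`. -/
noncomputable def hopConfig {e : Sym2 V} (g : ρ.HopState e) : ρ.Config
  | .edge b => (0 : Fin (N.d b.edge))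
  | .msg i k => Fin.cases (motive := fun _ => Fin (ρ.dim i)) 0 (fun j =>
      if h : (ρ.hopDart ⟨i, j⟩).edge = e then g ⟨⟨i, j⟩, h⟩ else 0) k
  | .anc i j => if h : (ρ.hopDart ⟨i, j⟩).edge = e then g ⟨⟨i, j⟩, h⟩ else (0 : Fin (ρ.dim i))

/-- The state of the edge `e` is unused. -/
def Fresh (e : Sym2 V) (x : ρ.Config) : Prop :=
  (∀ a : N.graph.Dart, a.edge = e → (x (.edge a) : ℕ) = x (.edge a.symm)) ∧
    ∀ i j, (ρ.hopDart ⟨i, j⟩).edge = e →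
      (x (.msg i (Fin.succ j)) : ℕ) = 0 ∧ (x (.anc i j) : ℕ) = 0

/-- The state of the edge `e` has been turned into pairs for the hops along it. -/
def Ready (e : Sym2 V) (x : ρ.Config) : Prop :=
  (∀ a : N.graph.Dart, a.edge = e → (x (.edge a) : ℕ) = 0) ∧
    ∀ i j, (ρ.hopDart ⟨i, j⟩).edge = e → (x (.anc i j) : ℕ) = x (.msg i (Fin.succ j))

variable [Fintype V]

open Classical in
/-- The registers which belong to the directed edge `a`. -/
noncomputable def dartRegs (a : N.graph.Dart) : Finset ρ.Reg := Finset.univ.filter (ρ.OnDart a)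

variable {ρ}

@[simp] theorem mem_dartRegs {a : N.graph.Dart} {r : ρ.Reg} :
    r ∈ ρ.dartRegs a ↔ ρ.OnDart a r := by
  simp [dartRegs]

theorem restrict_eq_iff {a : N.graph.Dart} {x y : ρ.Config} :
    ((fun r : ρ.dartRegs a => x r) = fun r : ρ.dartRegs a => y r) ↔
      ∀ r, ρ.OnDart a r → x r = y r := by
  simp [funext_iff]

theorem disjoint_dartRegs (a : N.graph.Dart) : Disjoint (ρ.dartRegs a) (ρ.dartRegs a.symm) := by
  rw [Finset.disjoint_left]
  intro r h1 h2
  rw [mem_dartRegs] at h1 h2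
  induction r using Reg.cases_hop with
  | edge b =>
    rw [onDart_edge] at h1 h2
    exact a.symm_ne (h2.symm.trans h1)
  | input i => exact not_onDart_input h1
  | receiver i j =>
    rw [onDart_msg_succ] at h1 h2
    rw [SimpleGraph.Dart.symm_symm] at h2
    exact a.symm_ne (h1.symm.trans h2)
  | sender i j =>
    rw [onDart_anc] at h1 h2
    exact a.symm_ne (h2.symm.trans h1)

omit [Fintype V] in
theorem edgeConfig_edge_val {a b : N.graph.Dart} (h : b.edge = a.edge) (n : Fin (N.d a.edge)) :
    (ρ.edgeConfig a n (.edge b) : ℕ) = n := by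
  have : ρ.edgeConfig a n (.edge b) = Fin.cast (congrArg N.d h.symm) n := dif_pos h
  rw [this]
  rfl

omit [Fintype V] in
theorem edgeConfig_eq_iff {a : N.graph.Dart} {n : Fin (N.d a.edge)} {b : N.graph.Dart}
    (hb : b.edge = a.edge) {x : ρ.Config} :
    (∀ r, ρ.OnDart b r → x r = ρ.edgeConfig a n r) ↔ (x (.edge b) : ℕ) = n ∧
      (∀ i j, ρ.hopDart ⟨i, j⟩ = b.symm → (x (.msg i (Fin.succ j)) : ℕ) = 0) ∧
      (∀ i j, ρ.hopDart ⟨i, j⟩ = b → (x (.anc i j) : ℕ) = 0) := by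
  constructor
  · intro h
    refine ⟨?_, fun i j hij => ?_, fun i j hij => ?_⟩
    · rw [h _ (onDart_edge.mpr rfl)]
      exact edgeConfig_edge_val hb n
    · rw [h _ (onDart_msg_succ.mpr hij)]
      simp [edgeConfig]
    · rw [h _ (onDart_anc.mpr hij)]
      simp [edgeConfig]
  · rintro ⟨h1, h2, h3⟩ r hr
    apply Fin.ext
    induction r using Reg.cases_hop with
    | edge c =>
      rw [onDart_edge] at hr
      subst hr
      rw [h1, edgeConfig_edge_val hb n]
    | input i => exact absurd hr not_onDart_input
    | receiver i j => rw [h2 i j (onDart_msg_succ.mp hr)]; simp [edgeConfig]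
    | sender i j => rw [h3 i j (onDart_anc.mp hr)]; simp [edgeConfig]

omit [Fintype V] in
theorem hopConfig_eq_iff {e : Sym2 V} {g : ρ.HopState e} {b : N.graph.Dart}
    (hb : b.edge = e) {x : ρ.Config} :
    (∀ r, ρ.OnDart b r → x r = ρ.hopConfig g r) ↔ (x (.edge b) : ℕ) = 0 ∧
      (∀ i j, ∀ h : (ρ.hopDart ⟨i, j⟩).edge = e, ρ.hopDart ⟨i, j⟩ = b.symm →
        (x (.msg i (Fin.succ j)) : ℕ) = g ⟨⟨i, j⟩, h⟩) ∧
      (∀ i j, ∀ h : (ρ.hopDart ⟨i, j⟩).edge = e, ρ.hopDart ⟨i, j⟩ = b →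
        (x (.anc i j) : ℕ) = g ⟨⟨i, j⟩, h⟩) := by
  constructor
  · intro h
    refine ⟨?_, fun i j he hij => ?_, fun i j he hij => ?_⟩
    · rw [h _ (onDart_edge.mpr rfl)]
      simp [hopConfig]
    · rw [h _ (onDart_msg_succ.mpr hij)]
      simp [hopConfig, he]
    · rw [h _ (onDart_anc.mpr hij)]
      simp [hopConfig, he]
  · rintro ⟨h1, h2, h3⟩ r hr
    apply Fin.ext
    induction r using Reg.cases_hop with
    | edge c =>
      rw [onDart_edge] at hr
      subst hr
      simp [hopConfig, h1]
    | input i => exact absurd hr not_onDart_input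
    | receiver i j =>
      have hd := onDart_msg_succ.mp hr
      have he : (ρ.hopDart ⟨i, j⟩).edge = e := by rw [hd, SimpleGraph.Dart.edge_symm, hb]
      rw [h2 i j he hd]
      simp [hopConfig, he]
    | sender i j =>
      have hd := onDart_anc.mp hr
      have he : (ρ.hopDart ⟨i, j⟩).edge = e := by rw [hd, hb]
      rw [h3 i j he hd]
      simp [hopConfig, he]

theorem edgeConfig_injective {a b : N.graph.Dart} (hb : b.edge = a.edge) :
    Function.Injective fun (n : Fin (N.d a.edge)) (r : ρ.dartRegs b) => ρ.edgeConfig a n r := by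
  intro n n' h
  have h1 := ((edgeConfig_eq_iff hb).mp (restrict_eq_iff.mp h)).1
  have h2 := ((edgeConfig_eq_iff (ρ := ρ) (n := n) hb).mp fun _ _ => rfl).1
  exact Fin.ext (h2.symm.trans h1)

theorem hopConfig_injective {e : Sym2 V} {b : N.graph.Dart} (hb : b.edge = e) :
    Function.Injective fun (g : ρ.HopState e) (r : ρ.dartRegs b) => ρ.hopConfig g r := by
  intro g g' h
  have h1 := (hopConfig_eq_iff hb).mp (restrict_eq_iff.mp h)
  have h2 := (hopConfig_eq_iff (g := g) hb).mp fun _ _ => rfl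
  funext ⟨⟨i, j⟩, he⟩
  apply Fin.ext
  rcases eq_or_eq_symm_of_edge_eq (he.trans hb.symm) with hd | hd
  · exact (h2.2.2 i j he hd).symm.trans (h1.2.2 i j he hd)
  · exact (h2.2.1 i j he hd).symm.trans (h1.2.1 i j he hd)

/-- Identifies the support of the edge state, written as a sum over `n` of product states of the two
ends, with the condition `Fresh`. -/
theorem exists_edgeConfig_iff {a : N.graph.Dart} {x : ρ.Config} :
    (∃ n, ((fun r : ρ.dartRegs a => x r) = fun r : ρ.dartRegs a => ρ.edgeConfig a n r) ∧
      ((fun r : ρ.dartRegs a.symm => x r) = fun r : ρ.dartRegs a.symm => ρ.edgeConfig a n r)) ↔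
      ρ.Fresh a.edge x := by
  simp only [restrict_eq_iff, edgeConfig_eq_iff rfl, edgeConfig_eq_iff a.edge_symm,
    SimpleGraph.Dart.symm_symm]
  constructor
  · rintro ⟨n, ⟨h1, h2, h3⟩, h4, h5, h6⟩
    refine ⟨fun b hb => ?_, fun i j hij => ?_⟩
    · rcases eq_or_eq_symm_of_edge_eq hb with rfl | rfl
      · exact h1.trans h4.symm
      · rw [SimpleGraph.Dart.symm_symm]
        exact h4.trans h1.symm
    · rcases eq_or_eq_symm_of_edge_eq hij with hd | hd
      · exact ⟨h5 i j hd, h3 i j hd⟩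
      · exact ⟨h2 i j hd, h6 i j hd⟩
  · rintro ⟨h1, h2⟩
    have he : ∀ {i j}, ρ.hopDart ⟨i, j⟩ = a.symm → (ρ.hopDart ⟨i, j⟩).edge = a.edge := by
      intro i j h
      rw [h, SimpleGraph.Dart.edge_symm]
    exact ⟨x (.edge a), ⟨rfl, fun i j h => (h2 i j (he h)).1, fun i j h => (h2 i j (by rw [h])).2⟩,
      (h1 a rfl).symm, fun i j h => (h2 i j (by rw [h])).1, fun i j h => (h2 i j (he h)).2⟩

/-- The counterpart for the state after preparation: a maximally entangled state over all `g` is the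
product of the pairs for the single hops. -/
theorem exists_hopConfig_iff {a : N.graph.Dart} {x : ρ.Config} :
    (∃ g : ρ.HopState a.edge,
      ((fun r : ρ.dartRegs a => x r) = fun r : ρ.dartRegs a => ρ.hopConfig g r) ∧
      ((fun r : ρ.dartRegs a.symm => x r) = fun r : ρ.dartRegs a.symm => ρ.hopConfig g r)) ↔
      ρ.Ready a.edge x := by
  simp only [restrict_eq_iff, hopConfig_eq_iff rfl, hopConfig_eq_iff a.edge_symm,
    SimpleGraph.Dart.symm_symm]
  constructor
  · rintro ⟨n, ⟨h1, h2, h3⟩, h4, h5, h6⟩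
    refine ⟨fun b hb => ?_, fun i j hij => ?_⟩
    · rcases eq_or_eq_symm_of_edge_eq hb with rfl | rfl
      · exact h1
      · exact h4
    · rcases eq_or_eq_symm_of_edge_eq hij with hd | hd
      · exact (h3 i j hij hd).trans (h5 i j hij hd).symm
      · exact (h6 i j hij hd).trans (h2 i j hij hd).symm
  · rintro ⟨h1, h2⟩
    -- The joint state of the pairs is read off the senders' halves.
    exact ⟨fun h => x (.anc h.1.1 h.1.2), ⟨h1 a rfl, fun i j he _ => (h2 i j he).symm,
      fun i j _ _ => rfl⟩, h1 _ a.edge_symm, fun i j he _ => (h2 i j he).symm, fun i j _ _ => rfl⟩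

open Classical in
variable (ρ) in
/-- The two ends of the edge of `a` turn its state into pairs for the hops along it. -/
noncomputable def prepareEdge (hcap : ∀ a, ρ.load a * ρ.load a.symm ≤ N.d a.edge)
    (a : N.graph.Dart) : LOCC ρ.loc ρ.regDim :=
  Distill.distill a.fst a.snd (ρ.dartRegs a) (ρ.dartRegs a.symm)
    (fun _ hr => loc_eq_of_onDart (mem_dartRegs.mp hr))
    (fun _ hr => loc_eq_of_onDart (mem_dartRegs.mp hr))
    -- The capacity bound is what makes room for all hop states among the `N.d a.edge` edge states.
    (fun g => Fin.castLE ((ρ.card_hopState a).trans_le (hcap a)) (Fintype.equivFin _ g))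
    ((Fin.castLE_injective _).comp (Fintype.equivFin _).injective)
    (fun (g : ρ.HopState a.edge) r => ρ.hopConfig g r) (fun n r => ρ.edgeConfig a n r)
    (fun g r => ρ.hopConfig g r) (fun n r => ρ.edgeConfig a n r)
    (hopConfig_injective rfl) (edgeConfig_injective rfl)
    (hopConfig_injective a.edge_symm) (edgeConfig_injective a.edge_symm)

theorem prepareEdge_stepsOn (hcap : ∀ a, ρ.load a * ρ.load a.symm ≤ N.d a.edge)
    (a : N.graph.Dart) :
    (ρ.prepareEdge hcap a).StepsOn fun A => ∃ a, ∀ r ∈ A, ρ.OnDart a r := by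
  refine ⟨⟨a, fun r hr => mem_dartRegs.mp hr⟩, fun o => ?_⟩
  rcases o with _ | o
  · trivial
  · exact ⟨⟨a.symm, fun r hr => mem_dartRegs.mp hr⟩, fun _ => trivial⟩

open Classical in
-- Injectivity of `α` leaves at most one nonzero term. Entangled sums can thereby be handled as 0/1
-- conditions on configurations.
theorem sum_basisMap_mul {X Y H : Type*} [Fintype H] [DecidableEq X] [DecidableEq Y] {α : H → X}
    (hα : Function.Injective α) (β : H → Y) (x : X) (y : Y) :
    ∑ h, Distill.basisMap α x h * Distill.basisMap β y h =
      if ∃ h, x = α h ∧ y = β h then (1 : ℂ) else 0 := by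
  simp only [Distill.basisMap, Matrix.of_apply, ite_zero_mul_ite_zero, mul_one]
  split_ifs with h
  · obtain ⟨h, rfl, rfl⟩ := h
    rw [Finset.sum_eq_single h]
    · simp
    · intro h' _ hne
      rw [if_neg]
      exact fun h'' => hne (hα h''.1).symm
    · simp
  · push Not at h
    exact Finset.sum_eq_zero fun n _ => if_neg fun hn => h n hn.1 hn.2

open Classical in
theorem conveys_prepareEdge (hcap : ∀ a, ρ.load a * ρ.load a.symm ≤ N.d a.edge)
    (a : N.graph.Dart) {I : Type*} [Fintype I]
    {out : Matrix ρ.Config ρ.Config ℂ →ₗ[ℂ] Matrix I I ℂ} {χ : ρ.Config → I → ℂ}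
    (hχ : ∀ i, DependsOn (fun x => χ x i) {r | ¬ ρ.OnDart a r ∧ ¬ ρ.OnDart a.symm r})
    {Q : LOCC ρ.loc ρ.regDim}
    (h : Q.Conveys out (LOCC.columns ρ.regDim fun x i =>
      χ x i * if ρ.Ready a.edge x then 1 else 0)) :
    ((ρ.prepareEdge hcap a).append Q).Conveys out (LOCC.columns ρ.regDim fun x i =>
      χ x i * if ρ.Fresh a.edge x then 1 else 0) := by
  have e1 : (fun (x : ρ.Config) i => χ x i * if ρ.Fresh a.edge x then (1 : ℂ) else 0) =
      fun x i => ∑ n, χ x i *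
        (Distill.basisMap (fun n (r : ρ.dartRegs a) => ρ.edgeConfig a n r) (fun r => x r) n *
        Distill.basisMap (fun n (r : ρ.dartRegs a.symm) => ρ.edgeConfig a n r)
          (fun r => x r) n) := by
    funext x i
    rw [← Finset.mul_sum, sum_basisMap_mul (edgeConfig_injective rfl)]
    simp only [exists_edgeConfig_iff]
  have e2 : (fun (x : ρ.Config) i => χ x i * if ρ.Ready a.edge x then (1 : ℂ) else 0) =
      fun x i => ∑ g : ρ.HopState a.edge, χ x i *
        (Distill.basisMap (fun (g : ρ.HopState a.edge) (r : ρ.dartRegs a) => ρ.hopConfig g r)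
          (fun r => x r) g *
        Distill.basisMap (fun (g : ρ.HopState a.edge) (r : ρ.dartRegs a.symm) => ρ.hopConfig g r)
          (fun r => x r) g) := by
    funext x i
    rw [← Finset.mul_sum, sum_basisMap_mul (hopConfig_injective rfl)]
    simp only [exists_hopConfig_iff]
  rw [e1]
  rw [e2] at h
  refine Distill.conveys_distill _ _ _ _ (disjoint_dartRegs a) _ _ _ _ _ (fun i => ?_) h
  intro x y hxy
  exact hχ i fun r hr => hxy r (by simpa [not_or] using hr)

end Routing

end QuantumTensorNetwork

namespace QuantumTensorNetwork

namespace Routing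

variable {V : Type u} {N : QuantumTensorNetwork V} {ρ : Routing N}

theorem indicator_mul_indicator {p q r : Prop} [Decidable p] [Decidable q] [Decidable r]
    (h : p ∧ q ↔ r) :
    (if p then (1 : ℂ) else 0) * (if q then 1 else 0) = if r then 1 else 0 := by
  by_cases hp : p <;> by_cases hq : q <;> simp [hp, hq, ← h]

/-! ### Preparing all edges in turn. -/

section Preparation

theorem ne_edge_of_mem {a : N.graph.Dart} {e : Sym2 V} (he : e ≠ a.edge) {b : N.graph.Dart}
    (hb : b.edge = e) : b ≠ a ∧ b ≠ a.symm := by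
  constructor
  · rintro rfl
    exact he hb.symm
  · rintro rfl
    exact he (hb.symm.trans a.edge_symm)

/-- The registers that the preparation of `a` touches belong to its edge alone, so conditions on any
other edge do not see them. -/
theorem fresh_congr {a : N.graph.Dart} {e : Sym2 V} (he : e ≠ a.edge) {x y : ρ.Config}
    (h : ∀ r, ¬ ρ.OnDart a r ∧ ¬ ρ.OnDart a.symm r → x r = y r) :
    ρ.Fresh e x ↔ ρ.Fresh e y := by
  refine and_congr (forall₂_congr fun b hb => ?_) (forall₃_congr fun i j hij => ?_)
  · have h1 := ne_edge_of_mem he hb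
    have h2 := ne_edge_of_mem he (b.edge_symm.trans hb)
    rw [h (.edge b) h1, h (.edge b.symm) h2]
  · have h1 := ne_edge_of_mem he hij
    rw [h (.anc i j) (by rwa [onDart_anc, onDart_anc]),
      h (.msg i j.succ) (by rw [onDart_msg_succ, onDart_msg_succ, SimpleGraph.Dart.symm_symm]
                            exact h1.symm)]

theorem ready_congr {a : N.graph.Dart} {e : Sym2 V} (he : e ≠ a.edge) {x y : ρ.Config}
    (h : ∀ r, ¬ ρ.OnDart a r ∧ ¬ ρ.OnDart a.symm r → x r = y r) :
    ρ.Ready e x ↔ ρ.Ready e y := by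
  refine and_congr (forall₂_congr fun b hb => ?_) (forall₃_congr fun i j hij => ?_)
  · rw [h (.edge b) (ne_edge_of_mem he hb)]
  · have h1 := ne_edge_of_mem he hij
    rw [h (.anc i j) (by rwa [onDart_anc, onDart_anc]),
      h (.msg i j.succ) (by rw [onDart_msg_succ, onDart_msg_succ, SimpleGraph.Dart.symm_symm]
                            exact h1.symm)]

theorem inputs_congr {a : N.graph.Dart} {x y : ρ.Config}
    (h : ∀ r, ¬ ρ.OnDart a r ∧ ¬ ρ.OnDart a.symm r → x r = y r) : ρ.inputs x = ρ.inputs y :=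
  funext fun _ => h _ ⟨not_onDart_input, not_onDart_input⟩

/-- The states of the edges in `U` are unused, the others have been prepared for the hops. -/
def Prepared (U : Set (Sym2 V)) (e : Sym2 V) (x : ρ.Config) : Prop :=
  (e ∈ U → ρ.Fresh e x) ∧ (e ∉ U → ρ.Ready e x)

theorem prepared_empty_iff {x : ρ.Config} : (∀ e, Prepared ∅ e x) ↔
    (∀ a, (x (.edge a) : ℕ) = 0) ∧ ∀ i j, (x (.anc i j) : ℕ) = x (.msg i (Fin.succ j)) := by
  simp only [Prepared, Set.mem_empty_iff_false, false_imp_iff, true_and, not_false_eq_true,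
    true_imp_iff, Ready]
  exact ⟨fun h => ⟨fun a => (h _).1 a rfl, fun i j => (h _).2 i j rfl⟩,
    fun h e => ⟨fun a _ => h.1 a, fun i j _ => h.2 i j⟩⟩

theorem forall_fresh_iff {x : ρ.Config} : (∀ e, ρ.Fresh e x) ↔
    (∀ a : N.graph.Dart, (x (.edge a) : ℕ) = x (.edge a.symm)) ∧
      (∀ i k, (x (.msg i (Fin.succ k)) : ℕ) = 0) ∧ (∀ i k, (x (.anc i k) : ℕ) = 0) :=
  ⟨fun h => ⟨fun a => (h _).1 a rfl, fun i j => ((h _).2 i j rfl).1,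
    fun i j => ((h _).2 i j rfl).2⟩,
    fun h _ => ⟨fun a _ => h.1 a, fun i j _ => ⟨h.2.1 i j, h.2.2 i j⟩⟩⟩

variable [Fintype V] {I : Type*} [Fintype I]
  {out : Matrix ρ.Config ρ.Config ℂ →ₗ[ℂ] Matrix I I ℂ}

open Classical in
-- Induction over the list of edges. The conditions on different edges involve disjoint registers,
-- and an edge occurs only once, so that preparing the head moves exactly this edge from `Fresh` to
-- `Ready`.
theorem conveys_prepare (hcap : ∀ a, ρ.load a * ρ.load a.symm ≤ N.d a.edge)
    (v : I → ∀ i, Fin (ρ.dim i)) {L : List N.graph.Dart}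
    (hL : (L.map SimpleGraph.Dart.edge).Nodup) {Q : LOCC ρ.loc ρ.regDim}
    (h : Q.Conveys out (LOCC.columns ρ.regDim fun x i =>
      if ρ.inputs x = v i ∧ ∀ e, Prepared ∅ e x then 1 else 0)) :
    ((LOCC.seq (L.map (ρ.prepareEdge hcap))).append Q).Conveys out
      (LOCC.columns ρ.regDim fun x i =>
        if ρ.inputs x = v i ∧ ∀ e, Prepared {e | e ∈ L.map SimpleGraph.Dart.edge} e x
        then 1 else 0) := by
  induction L with
  | nil => simpa using h
  | cons a L ih =>
    rw [List.map_cons, List.nodup_cons] at hL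
    have ih := ih hL.2
    rw [List.map_cons, LOCC.seq_cons, LOCC.append_assoc]
    set U := {e | e ∈ (a :: L).map SimpleGraph.Dart.edge} with hU
    set U' := {e | e ∈ L.map SimpleGraph.Dart.edge} with hU'
    have haU : a.edge ∈ U := by simp [hU]
    have haU' : a.edge ∉ U' := hL.1
    have hne : ∀ e, e ≠ a.edge → (e ∈ U ↔ e ∈ U') := by
      intro e he
      simp only [hU, hU', List.map_cons, List.mem_cons, Set.mem_ofPred_eq, he, false_or]
    -- The spectator factor `χ` collects the input and the conditions on all other edges.
    have key := conveys_prepareEdge hcap a (out := out) (χ := fun x i =>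
      if ρ.inputs x = v i ∧ ∀ e, e ≠ a.edge → Prepared U e x then 1 else 0)
      (Q := (LOCC.seq (L.map (ρ.prepareEdge hcap))).append Q) ?_ ?_
    · refine key.congr fun x i => ?_
      refine indicator_mul_indicator ?_
      rw [and_assoc]
      refine and_congr_right fun _ => ⟨fun h' e => ?_, fun h' => ⟨fun e _ => h' e, (h' _).1 haU⟩⟩
      by_cases he : e = a.edge
      · subst he
        exact ⟨fun _ => h'.2, fun h'' => absurd haU h''⟩
      · exact h'.1 e he
    · intro i x y hxy
      have : (ρ.inputs x = v i ∧ ∀ e, e ≠ a.edge → Prepared U e x) ↔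
          (ρ.inputs y = v i ∧ ∀ e, e ≠ a.edge → Prepared U e y) := by
        rw [inputs_congr hxy]
        refine and_congr_right fun _ => forall₂_congr fun e he => ?_
        rw [Prepared, Prepared, fresh_congr he hxy, ready_congr he hxy]
      simp only [this]
    · refine ih.congr fun x i => ?_
      refine (indicator_mul_indicator ?_).symm
      rw [and_assoc]
      refine and_congr_right fun _ => ⟨fun h' e => ?_, fun h' => ⟨fun e he => ?_, (h' _).2 haU'⟩⟩
      · by_cases he : e = a.edge
        · subst he
          exact ⟨fun h'' => absurd h'' haU', fun _ => h'.2⟩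
        · have := h'.1 e he
          rwa [Prepared, hne e he] at this
      · rw [Prepared, hne e he]
        exact h' e

omit [Fintype V] in
theorem exists_dart_edge_eq {e : Sym2 V} (he : e ∈ N.graph.edgeSet) :
    ∃ a : N.graph.Dart, a.edge = e := by
  induction e using Sym2.ind with
  | _ u v => exact ⟨⟨(u, v), he⟩, rfl⟩

variable (N) in
open Classical in
/-- Every edge, with one of its two directions. -/
noncomputable def orientedEdges : List N.graph.Dart :=
  N.graph.edgeFinset.attach.toList.map fun e =>
    (exists_dart_edge_eq (SimpleGraph.mem_edgeFinset.mp e.2)).choose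

variable (N) in
open Classical in
theorem map_edge_orientedEdges :
    (orientedEdges N).map SimpleGraph.Dart.edge = N.graph.edgeFinset.attach.toList.map (·.1) := by
  rw [orientedEdges, List.map_map]
  exact List.map_congr_left fun e _ =>
    (exists_dart_edge_eq (SimpleGraph.mem_edgeFinset.mp e.2)).choose_spec

variable (N) in
theorem nodup_orientedEdges : ((orientedEdges N).map SimpleGraph.Dart.edge).Nodup := by
  classical
  rw [map_edge_orientedEdges]
  exact (Finset.nodup_toList _).map Subtype.val_injective

theorem mem_map_edge_orientedEdges {e : Sym2 V} :
    e ∈ (orientedEdges N).map SimpleGraph.Dart.edge ↔ e ∈ N.graph.edgeSet := by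
  classical
  rw [map_edge_orientedEdges]
  simp

end Preparation

/-! ### The teleportation phase -/

section Teleportation

theorem conveys_hop [Fintype V] {I : Type*} [Fintype I]
    {out : Matrix ρ.Config ρ.Config ℂ →ₗ[ℂ] Matrix I I ℂ} (i : Fin ρ.n)
    (k : Fin (ρ.route i).length) {χ : ρ.Config → I → ℂ}
    (hχ : ∀ a, DependsOn (fun x => χ x a)
      ({.msg i k.castSucc, .anc i k, .msg i k.succ} : Set ρ.Reg)ᶜ)
    {v : I → Fin (ρ.dim i)} {Q : LOCC ρ.loc ρ.regDim}
    (h : ∀ j₀ k₀, Q.Conveys out (LOCC.columns ρ.regDim fun x a => χ x a *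
      Teleport.bell (ρ.dim i) j₀ k₀ (x (.msg i k.castSucc)) (x (.anc i k)) *
        if (x (.msg i k.succ) : ℕ) = v a then 1 else 0)) :
    ((ρ.hop i k).append Q).Conveys out (LOCC.columns ρ.regDim fun x a => χ x a *
      if (x (.msg i k.castSucc) : ℕ) = v a ∧ (x (.anc i k) : ℕ) = x (.msg i k.succ)
        then 1 else 0) := by
  have hac : (Reg.msg i k.castSucc : ρ.Reg) ≠ .msg i k.succ := by simp [Fin.ext_iff]
  have hbc : (Reg.anc i k : ρ.Reg) ≠ .msg i k.succ := by simp
  exact Teleport.conveys_teleport (by simp) hac hbc rfl rfl rfl rfl rfl rfl (ρ.dim_pos i).ne' hχ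
    (fun a => (v a).2) h

/-- The system on the `i`-th route has come to the position `m i`, where it is in the state `v i`,
and the pairs for its remaining hops are unused. -/
def Carried (m : ∀ i, Fin ((ρ.route i).length + 1)) (v : ∀ i, Fin (ρ.dim i)) (x : ρ.Config)
    (i : Fin ρ.n) : Prop :=
  (x (.msg i (m i)) : ℕ) = v i ∧
    ∀ j : Fin (ρ.route i).length, (m i : ℕ) ≤ j → (x (.anc i j) : ℕ) = x (.msg i j.succ)

/-- The registers which are out of use when the systems have come to the positions `m`. -/
def used (m : ∀ i, Fin ((ρ.route i).length + 1)) : Set ρ.Reg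
  | .edge _ => True
  | .msg i k => k < m i
  | .anc i j => (j : ℕ) < m i

variable [Fintype V] {I : Type*} [Fintype I]
  {out : Matrix ρ.Config ρ.Config ℂ →ₗ[ℂ] Matrix I I ℂ}

open Classical in
/-- The states in which the systems have come to the positions `m`. -/
noncomputable def transit (v : I → ∀ i, Fin (ρ.dim i)) (χ : ρ.Config → ℂ)
    (m : ∀ i, Fin ((ρ.route i).length + 1)) : Matrix ρ.Config I ℂ :=
  LOCC.columns ρ.regDim fun x a => χ x * if ∀ i, Carried m (v a) x i then 1 else 0

/-- The protocol `Q` completes the transmission of systems which have come to the positions `m`. -/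
def Completes (out : Matrix ρ.Config ρ.Config ℂ →ₗ[ℂ] Matrix I I ℂ)
    (v : I → ∀ i, Fin (ρ.dim i)) (m : ∀ i, Fin ((ρ.route i).length + 1))
    (Q : LOCC ρ.loc ρ.regDim) : Prop :=
  ∀ χ : ρ.Config → ℂ, DependsOn χ (used m) → Q.Conveys out (transit v χ m)

open Classical in
-- The conditions `Carried` split into those on the three registers of the hop and those elsewhere,
-- which are spectators. The Bell vector left behind joins `χ`: the hop has just turned the two
-- measured registers into used ones.
theorem Completes.hop {v : I → ∀ i, Fin (ρ.dim i)} {m m' : ∀ i, Fin ((ρ.route i).length + 1)}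
    {i : Fin ρ.n} {k : Fin (ρ.route i).length} (hm : m i = k.castSucc) (hm' : m' i = k.succ)
    (hne : ∀ i', i' ≠ i → m' i' = m i') {Q : LOCC ρ.loc ρ.regDim} (h : Completes out v m' Q) :
    Completes out v m ((ρ.hop i k).append Q) := by
  intro χ hχ
  have key := conveys_hop (out := out) (Q := Q) i k
    (χ := fun x a => χ x * if (∀ i', i' ≠ i → Carried m (v a) x i') ∧
      ∀ j : Fin (ρ.route i).length, (k : ℕ) < j → (x (.anc i j) : ℕ) = x (.msg i j.succ)
        then 1 else 0) ?_ (v := fun a => v a i) ?_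
  · refine key.congr fun x a => ?_
    rw [mul_assoc]
    congr 1
    refine indicator_mul_indicator ?_
    constructor
    · rintro ⟨⟨h1, h2⟩, h3, h4⟩ i'
      by_cases hi : i' = i
      · subst hi
        refine ⟨by rw [hm]; exact h3, fun j hj => ?_⟩
        rw [hm] at hj
        rcases hj.lt_or_eq with hj | hj
        · exact h2 j hj
        · obtain rfl : k = j := Fin.ext hj
          exact h4
      · exact h1 i' hi
    · intro h'
      have hi := h' i
      rw [Carried, hm] at hi
      exact ⟨⟨fun i' _ => h' i', fun j hj => hi.2 j hj.le⟩, hi.1, hi.2 k le_rfl⟩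
  · intro a x y hxy
    have hxy' : ∀ r, r ≠ .msg i k.castSucc → r ≠ .anc i k → r ≠ .msg i k.succ → x r = y r :=
      fun r h1 h2 h3 => hxy r (by simp [h1, h2, h3])
    have e1 : χ x = χ y := by
      refine hχ fun r hr => hxy' r ?_ ?_ ?_
      · rintro rfl
        have : k.castSucc < m i := hr
        rw [hm] at this
        exact lt_irrefl _ this
      · rintro rfl
        have : (k : ℕ) < m i := hr
        rw [hm] at this
        exact lt_irrefl _ this
      · rintro rfl
        have : k.succ < m i := hr
        rw [hm, Fin.lt_def] at this
        simp at this
    have e2 : ((∀ i', i' ≠ i → Carried m (v a) x i') ∧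
        ∀ j : Fin (ρ.route i).length, (k : ℕ) < j → (x (.anc i j) : ℕ) = x (.msg i j.succ)) ↔
        ((∀ i', i' ≠ i → Carried m (v a) y i') ∧
        ∀ j : Fin (ρ.route i).length, (k : ℕ) < j → (y (.anc i j) : ℕ) = y (.msg i j.succ)) := by
      refine and_congr (forall₂_congr fun i' hi => ?_) (forall₂_congr fun j hj => ?_)
      · have h1 : ∀ k, x (.msg i' k) = y (.msg i' k) := fun k =>
          hxy' _ (fun h => hi (Reg.msg.inj h).1) (by simp) (fun h => hi (Reg.msg.inj h).1)
        have h2 : ∀ k, x (.anc i' k) = y (.anc i' k) := fun k =>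
          hxy' _ (by simp) (fun h => hi (Reg.anc.inj h).1) (by simp)
        simp only [Carried, h1, h2]
      · rw [hxy' (.anc i j) (by simp) (by simp [Fin.ext_iff]; omega) (by simp),
          hxy' (.msg i j.succ) (by simp [Fin.ext_iff]; omega) (by simp)
            (by simp [Fin.ext_iff]; omega)]
    simp only [e1, e2]
  · intro j₀ k₀
    -- The new `χ` includes the Bell vector of the measured registers.
    refine LOCC.Conveys.congr (h (fun x => χ x *
      Teleport.bell (ρ.dim i) j₀ k₀ (x (.msg i k.castSucc)) (x (.anc i k))) ?_) fun x a => ?_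
    swap
    · conv_rhs => rw [mul_right_comm, mul_assoc (χ x), mul_right_comm]
      congr 1
      refine (indicator_mul_indicator ?_).symm
      constructor
      · rintro ⟨⟨h1, h2⟩, h3⟩ i'
        by_cases hi : i' = i
        · subst hi
          refine ⟨by rw [hm']; exact h3, fun j hj => ?_⟩
          rw [hm'] at hj
          exact h2 j hj
        · have := h1 i' hi
          rwa [Carried, ← hne i' hi] at this
      · intro h'
        have hi := h' i
        rw [Carried, hm'] at hi
        refine ⟨⟨fun i' hi' => ?_, fun j hj => hi.2 j hj⟩, hi.1⟩
        rw [Carried, ← hne i' hi']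
        exact h' i'
    · intro x y hxy
      have e1 : χ x = χ y := by
        refine hχ fun r hr => hxy r ?_
        have hle : ∀ i', m i' ≤ m' i' := by
          intro i'
          by_cases hi : i' = i
          · subst hi
            rw [hm, hm', Fin.le_def]
            simp
          · rw [hne i' hi]
        rcases r with b | ⟨i', k'⟩ | ⟨i', k'⟩
        · trivial
        · exact lt_of_lt_of_le (show k' < m i' from hr) (hle i')
        · exact lt_of_lt_of_le (show (k' : ℕ) < m i' from hr) (hle i')
      have e2 : x (.msg i k.castSucc) = y (.msg i k.castSucc) :=
        hxy _ (show k.castSucc < m' i by rw [hm', Fin.lt_def]; simp)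
      have e3 : x (.anc i k) = y (.anc i k) :=
        hxy _ (show (k : ℕ) < m' i by rw [hm']; simp)
      simp only [e1, e2, e3]

theorem Completes.route {v : I → ∀ i, Fin (ρ.dim i)} {m' : ∀ i, Fin ((ρ.route i).length + 1)}
    {i : Fin ρ.n} (hm' : m' i = Fin.last _) {Q : LOCC ρ.loc ρ.regDim}
    (h : Completes out v m' Q) {m : ∀ i, Fin ((ρ.route i).length + 1)}
    (hne : ∀ i', i' ≠ i → m' i' = m i') :
    Completes out v m
      ((LOCC.seq (((List.finRange (ρ.route i).length).drop (m i)).map (ρ.hop i))).append Q) := by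
  -- Induction on the number `k` of remaining hops of this route.
  obtain ⟨k, hk⟩ : ∃ k : ℕ, (m i : ℕ) + k = (ρ.route i).length :=
    ⟨(ρ.route i).length - m i, by have := (m i).2; omega⟩
  induction k generalizing m with
  | zero =>
    have hmm : m = m' := by
      funext i'
      by_cases hi : i' = i
      · subst hi
        rw [hm']
        exact Fin.ext hk
      · exact (hne i' hi).symm
    rw [List.drop_of_length_le (by simp; omega)]
    rw [hmm]
    exact h
  | succ k ih =>
    have hlt : (m i : ℕ) < (ρ.route i).length := by omega
    rw [List.drop_eq_getElem_cons (by simpa using hlt), List.map_cons, LOCC.seq_cons,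
      LOCC.append_assoc]
    have hih := @ih (Function.update m i (Fin.succ ⟨m i, hlt⟩)) (fun i' hi => by
      rw [Function.update_of_ne hi, hne i' hi]) (by
      rw [Function.update_self]
      simp
      omega)
    rw [Function.update_self] at hih
    refine Completes.hop (m' := Function.update m i (Fin.succ ⟨m i, hlt⟩)) ?_ ?_
      (fun i' hi => by rw [Function.update_of_ne hi]) hih
    · ext; simp
    · rw [Function.update_self]
      ext; simp

theorem completes_teleportAll {v : I → ∀ i, Fin (ρ.dim i)}
    (h : Completes out v (fun _ => Fin.last _) (.done : LOCC ρ.loc ρ.regDim)) :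
    Completes out v (fun _ => 0) ρ.teleportAll := by
  -- The routes below `q` are finished and the other `k` have not started; induction on `k`.
  have key : ∀ k q : ℕ, q + k = ρ.n → Completes out v
      (fun i => if (i : ℕ) < q then Fin.last _ else 0)
      (LOCC.seq (((List.finRange ρ.n).drop q).flatMap fun i =>
        (List.finRange (ρ.route i).length).map (ρ.hop i))) := by
    intro k
    induction k with
    | zero =>
      intro q hq
      rw [List.drop_of_length_le (by simp; omega)]
      have : (fun i : Fin ρ.n => if (i : ℕ) < q then Fin.last (ρ.route i).length else 0) =
          fun _ => Fin.last _ := by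
        funext i
        rw [if_pos (by omega)]
      rw [this]
      exact h
    | succ k ih =>
      intro q hq
      have hlt : q < ρ.n := by omega
      rw [List.drop_eq_getElem_cons (by simpa using hlt), List.flatMap_cons, LOCC.seq_append]
      have h1 := ih (q + 1) (by omega)
      have hi : (List.finRange ρ.n)[q]'(by simpa using hlt) = ⟨q, hlt⟩ := by ext; simp
      rw [hi]
      have h2 := Completes.route (i := ⟨q, hlt⟩) (by simp) h1
        (m := fun i => if (i : ℕ) < q then Fin.last _ else 0) (fun i' hi' => by
          have : (i' : ℕ) ≠ q := fun h => hi' (Fin.ext h)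
          by_cases hlt' : (i' : ℕ) < q
          · rw [if_pos hlt', if_pos (by omega)]
          · rw [if_neg hlt', if_neg (by omega)])
      simpa using h2
  have := key ρ.n 0 (by simp)
  simpa [teleportAll] using this

end Teleportation

end Routing

end QuantumTensorNetwork

namespace QuantumTensorNetwork

namespace Routing

open Matrix

variable {V : Type u} [Fintype V] {N : QuantumTensorNetwork V} (ρ : Routing N)

/-! ### Input and output -/

variable {D : ℕ} (enc : Fin D ≃ ∀ i, Fin (ρ.dim i))

/-- The reduction to the output registers as a linear map. -/
noncomputable def reducedLinear : Matrix ρ.Config ρ.Config ℂ →ₗ[ℂ] Matrix (Fin D) (Fin D) ℂ where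
  toFun := ρ.reduced enc
  map_add' σ σ' := by
    ext a b
    simp only [reduced, Matrix.add_apply, ← Finset.sum_add_distrib]
    refine Finset.sum_congr rfl fun x _ => Finset.sum_congr rfl fun y _ => ?_
    split_ifs <;> simp
  map_smul' c σ := by
    ext a b
    simp only [reduced, Matrix.smul_apply, smul_eq_mul, RingHom.id_apply, Finset.mul_sum]
    refine Finset.sum_congr rfl fun x _ => Finset.sum_congr rfl fun y _ => ?_
    split_ifs <;> simp

/-- A term on the diagonal forces `a` to be the output of `x`, and then `y = x`. -/
theorem trace_reduced (σ : Matrix ρ.Config ρ.Config ℂ) : (ρ.reduced enc σ).trace = σ.trace := by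
  simp only [Matrix.trace, Matrix.diag_apply, reduced]
  rw [Finset.sum_comm]
  refine Finset.sum_congr rfl fun x _ => ?_
  rw [Finset.sum_eq_single (enc.symm (ρ.outputs x)), Finset.sum_eq_single x]
  · simp
  · intro y _ hy
    rw [if_neg]
    rintro ⟨h1, h2, h3⟩
    refine hy ?_
    rw [Equiv.apply_symm_apply] at h2
    funext r
    by_cases hr : ∀ i, r ≠ .msg i (Fin.last _)
    · exact (h3 r hr).symm
    · push Not at hr
      obtain ⟨i, rfl⟩ := hr
      exact congrFun h2 i
  · simp
  · intro a _ ha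
    refine Finset.sum_eq_zero fun y _ => if_neg ?_
    rintro ⟨h1, _⟩
    exact ha (by rw [h1, Equiv.symm_apply_apply])
  · simp

open Classical in
/-- Replace the states of the output registers. -/
noncomputable def setOutputs (x : ρ.Config) (v : ∀ i, Fin (ρ.dim i)) : ρ.Config
  | .msg i k => if k = Fin.last _ then v i else x (.msg i k)
  | .edge a => x (.edge a)
  | .anc i j => x (.anc i j)

variable {ρ}

omit [Fintype V] in
@[simp] theorem outputs_setOutputs (x : ρ.Config) (v : ∀ i, Fin (ρ.dim i)) :
    ρ.outputs (ρ.setOutputs x v) = v := by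
  funext i
  simp [outputs, setOutputs]

omit [Fintype V] in
theorem setOutputs_of_ne (x : ρ.Config) (v : ∀ i, Fin (ρ.dim i)) {r : ρ.Reg}
    (hr : ∀ i, r ≠ .msg i (Fin.last _)) : ρ.setOutputs x v r = x r := by
  rcases r with a | ⟨i, k⟩ | ⟨i, k⟩
  · rfl
  · have : k ≠ Fin.last _ := fun h => hr i (by rw [h])
    simp [setOutputs, this]
  · rfl

omit [Fintype V] in
theorem eq_setOutputs {x y : ρ.Config} {v : ∀ i, Fin (ρ.dim i)} (hy : ρ.outputs y = v)
    (h : ∀ r, (∀ i, r ≠ .msg i (Fin.last _)) → x r = y r) : y = ρ.setOutputs x v := by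
  funext r
  by_cases hr : ∀ i, r ≠ .msg i (Fin.last _)
  · rw [setOutputs_of_ne x v hr, h r hr]
  · push Not at hr
    obtain ⟨i, rfl⟩ := hr
    exact (congrFun hy i).trans (congrFun (outputs_setOutputs x v) i).symm

open Classical in
-- Resetting the outputs is a bijection between the two fibres.
theorem sum_outputs_eq {F : ρ.Config → ℂ} (hF : ∀ x v, F (ρ.setOutputs x v) = F x)
    (v v' : ∀ i, Fin (ρ.dim i)) :
    ∑ x, (if ρ.outputs x = v then F x else 0) = ∑ x, if ρ.outputs x = v' then F x else 0 := by
  rw [← Finset.sum_filter, ← Finset.sum_filter]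
  refine Finset.sum_nbij' (fun x => ρ.setOutputs x v') (fun x => ρ.setOutputs x v) ?_ ?_ ?_ ?_ ?_
  · simp
  · simp
  · intro x hx
    rw [Finset.mem_filter] at hx
    exact (eq_setOutputs hx.2 fun r hr => setOutputs_of_ne x v' hr).symm
  · intro x hx
    rw [Finset.mem_filter] at hx
    exact (eq_setOutputs hx.2 fun r hr => setOutputs_of_ne x v hr).symm
  · intro x _
    exact (hF x v').symm

omit [Fintype V] in
theorem carried_last_iff {v : ∀ i, Fin (ρ.dim i)} {x : ρ.Config} :
    (∀ i, Carried (fun _ => Fin.last _) v x i) ↔ ρ.outputs x = v := by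
  rw [funext_iff]
  refine forall_congr' fun i => ?_
  rw [Carried, Fin.ext_iff]
  refine ⟨fun h => h.1, fun h => ⟨h, fun j hj => ?_⟩⟩
  have := j.2
  simp only [Fin.val_last] at hj
  omega

theorem mul_mul_conjTranspose_apply {X I : Type*} [Fintype I] (M : Matrix X I ℂ)
    (τ : Matrix I I ℂ) (x y : X) :
    (M * τ * Mᴴ) x y = ∑ a, ∑ b, M x a * τ a b * (starRingEnd ℂ) (M y b) := by
  simp only [Matrix.mul_apply, Finset.sum_mul, conjTranspose_apply]
  exact Finset.sum_comm

open Classical in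
-- At the end `χ` ignores the output registers, so the state factors into the output and garbage.
-- The partial trace yields `τ` times the squared norm of the garbage.
theorem completes_done :
    Completes (ρ.reducedLinear enc) enc (fun _ => Fin.last _) (.done : LOCC ρ.loc ρ.regDim) := by
  intro χ hχ
  have hset : ∀ x v, χ (ρ.setOutputs x v) = χ x := by
    intro x v
    refine hχ fun r hr => setOutputs_of_ne x v ?_
    rintro i rfl
    exact lt_irrefl _ (show Fin.last _ < Fin.last _ from hr)
  have hF : ∀ x v, χ (ρ.setOutputs x v) * (starRingEnd ℂ) (χ (ρ.setOutputs x v)) =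
      χ x * (starRingEnd ℂ) (χ x) := fun x v => by rw [hset]
  let w : (∀ i, Fin (ρ.dim i)) → ℂ := fun v =>
    ∑ x, if ρ.outputs x = v then χ x * (starRingEnd ℂ) (χ x) else 0
  -- Any output value would serve: `w` is constant by `sum_outputs_eq`.
  refine ⟨w fun i => ⟨0, ρ.dim_pos i⟩, fun τ => ?_⟩
  ext a b
  rw [show w _ = w (enc a) from sum_outputs_eq hF _ _]
  have hM : ∀ x c, transit enc χ (fun _ => Fin.last _) x c =
      χ x * if ρ.outputs x = enc c then 1 else 0 := by
    intro x c
    exact congrArg (χ x * ·) (if_congr carried_last_iff rfl rfl)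
  change ∑ x, ∑ y, _ = w (enc a) * τ a b
  rw [Finset.sum_mul]
  refine Finset.sum_congr rfl fun x _ => ?_
  by_cases hx : ρ.outputs x = enc a
  · rw [if_pos hx, Finset.sum_eq_single (ρ.setOutputs x (enc b))]
    · rw [if_pos ⟨hx, outputs_setOutputs x _, fun r hr => (setOutputs_of_ne x _ hr).symm⟩,
        LOCC.run, mul_mul_conjTranspose_apply, Finset.sum_eq_single a, Finset.sum_eq_single b]
      · rw [hM, hM, hx, outputs_setOutputs, hset]
        simp only [if_true, mul_one]
        ring
      · intro c _ hc
        rw [hM (ρ.setOutputs x (enc b)), outputs_setOutputs,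
          if_neg fun h => hc (enc.injective h).symm]
        simp
      · simp
      · intro c _ hc
        refine Finset.sum_eq_zero fun c' _ => ?_
        rw [hM x, hx, if_neg fun h => hc (enc.injective h).symm]
        simp
      · simp
    · intro y _ hy
      exact if_neg fun h => hy (eq_setOutputs h.2.1 h.2.2)
    · simp
  · rw [if_neg hx, zero_mul]
    exact Finset.sum_eq_zero fun y _ => if_neg fun h => hx h.1

/-! ### The initial state and the correctness of the whole protocol. -/

variable (ρ)

open Classical in
/-- The initial states for the basis states of the input. -/
noncomputable def initialColumns : Matrix ρ.Config (Fin D) ℂ :=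
  LOCC.columns ρ.regDim fun x a => ρ.resource x * if ρ.inputs x = enc a then 1 else 0

theorem initial_eq (τ : Matrix (Fin D) (Fin D) ℂ) :
    ρ.initial enc τ = ρ.initialColumns enc * τ * (ρ.initialColumns enc)ᴴ := by
  ext x y
  rw [mul_mul_conjTranspose_apply, Finset.sum_eq_single (enc.symm (ρ.inputs x)),
    Finset.sum_eq_single (enc.symm (ρ.inputs y))]
  · simp only [initial, initialColumns, Matrix.of_apply, Equiv.apply_symm_apply, if_true, mul_one]
    ring
  · intro b _ hb
    have : ρ.inputs y ≠ enc b := fun h => hb (by rw [h, Equiv.symm_apply_apply])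
    simp [initialColumns, this]
  · simp
  · intro a _ ha
    have : ρ.inputs x ≠ enc a := fun h => ha (by rw [h, Equiv.symm_apply_apply])
    simp [initialColumns, this]
  · simp

/-- The configurations in which the halves of the edge states agree, the input is `v`, and all
other registers are in the state `0`, are given by the states of the edges. -/
noncomputable def initialConfig (v : ∀ i, Fin (ρ.dim i)) (n : ∀ e : N.graph.edgeSet, Fin (N.d e)) :
    ρ.Config
  | .edge a => n ⟨a.edge, a.edge_mem⟩
  | .msg i k => Fin.cases (motive := fun _ => Fin (ρ.dim i)) (v i) (fun _ => 0) k
  | .anc i _ => (0 : Fin (ρ.dim i))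

open Classical in
-- The resource is normalized: its support with input `v` has one configuration for each choice of
-- edge states, each of weight `∏ 1 / d e`.
theorem sum_resource (v : ∀ i, Fin (ρ.dim i)) :
    ∑ x, (if ρ.inputs x = v then ρ.resource x * (starRingEnd ℂ) (ρ.resource x) else 0) = 1 := by
  have hc : (∏ e ∈ N.graph.edgeFinset, ((Real.sqrt (N.d e) : ℝ) : ℂ)⁻¹) *
      (starRingEnd ℂ) (∏ e ∈ N.graph.edgeFinset, ((Real.sqrt (N.d e) : ℝ) : ℂ)⁻¹) =
      (∏ e : N.graph.edgeSet, (N.d e : ℂ))⁻¹ := by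
    rw [map_prod, ← Finset.prod_mul_distrib, ← Finset.prod_inv_distrib]
    rw [Finset.prod_subtype N.graph.edgeFinset (p := (· ∈ N.graph.edgeSet)) (by simp)]
    refine Finset.prod_congr rfl fun e _ => ?_
    rw [map_inv₀, Complex.conj_ofReal, ← mul_inv, ← Complex.ofReal_mul,
      Real.mul_self_sqrt (Nat.cast_nonneg _)]
    simp
  have hne : (∏ e : N.graph.edgeSet, (N.d e : ℂ)) ≠ 0 := by
    refine Finset.prod_ne_zero_iff.mpr fun e _ => ?_
    have := N.two_le_d e e.2
    exact_mod_cast (by omega : N.d e ≠ 0)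
  have hval : ∀ n, ρ.resource (ρ.initialConfig v n) =
      ∏ e ∈ N.graph.edgeFinset, ((Real.sqrt (N.d e) : ℝ) : ℂ)⁻¹ := by
    intro n
    rw [resource, if_pos]
    refine ⟨fun a => ?_, fun i k => by simp [initialConfig], fun i k => by simp [initialConfig]⟩
    have : ∀ {e e' : N.graph.edgeSet}, e = e' → (n e : ℕ) = n e' := by
      rintro e _ rfl
      rfl
    exact this (Subtype.ext a.edge_symm.symm)
  have hin : ∀ n, ρ.inputs (ρ.initialConfig v n) = v := fun n => rfl
  have key : ∑ n : (∀ e : N.graph.edgeSet, Fin (N.d e)),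
      (∏ e : N.graph.edgeSet, (N.d e : ℂ))⁻¹ =
      ∑ x, (if ρ.inputs x = v then ρ.resource x * (starRingEnd ℂ) (ρ.resource x) else 0) := by
    refine Finset.sum_of_injOn (ρ.initialConfig v) ?_ (fun _ _ => by simp) ?_ ?_
    · intro n _ n' _ h
      funext ⟨e, he⟩
      obtain ⟨a, rfl⟩ := exists_dart_edge_eq he
      exact congrFun h (.edge a)
    · intro x _ hx
      split_ifs with hv
      · rw [resource, if_neg, zero_mul]
        rintro ⟨h1, h2, h3⟩
        -- The edge state is read at an arbitrarily chosen end; `h1` says that the other end agrees.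
        refine hx ⟨fun e => Fin.cast (congrArg N.d (exists_dart_edge_eq e.2).choose_spec)
          (x (.edge (exists_dart_edge_eq e.2).choose) : Fin (N.d _)), by simp, ?_⟩
        funext r
        apply Fin.ext
        induction r using Reg.cases_hop with
        | edge a =>
          have ha := (exists_dart_edge_eq a.edge_mem).choose_spec
          change (x (.edge (exists_dart_edge_eq a.edge_mem).choose) : ℕ) = x (.edge a)
          rcases eq_or_eq_symm_of_edge_eq ha with h | h
          · rw [h]
          · rw [h, h1 a]
        | input i => exact congrArg Fin.val (congrFun hv i).symm
        | receiver i j => rw [h2]; simp [initialConfig]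
        | sender i j => rw [h3]; simp [initialConfig]
      · rfl
    · intro n _
      rw [if_pos (hin n), hval, hc]
  rw [← key, Finset.sum_const, Finset.card_univ, Fintype.card_pi, nsmul_eq_mul]
  simp only [Fintype.card_fin]
  rw [Nat.cast_prod, mul_inv_cancel₀ hne]

/-- The protocol which prepares the pairs for the hops edge by edge, and then teleports. -/
noncomputable def protocol (hcap : ∀ a, ρ.load a * ρ.load a.symm ≤ N.d a.edge) :
    TeleportationProtocol N where
  toRouting := ρ
  prep := LOCC.seq ((orientedEdges N).map (ρ.prepareEdge hcap))
  prep_on := LOCC.StepsOn.seq fun P hP => by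
    obtain ⟨a, _, rfl⟩ := List.mem_map.mp hP
    exact prepareEdge_stepsOn hcap a

variable {ρ}

open Classical in
theorem conveys_protocol (hcap : ∀ a, ρ.load a * ρ.load a.symm ≤ N.d a.edge) :
    (ρ.protocol hcap).toLOCC.Conveys (ρ.reducedLinear enc) (ρ.initialColumns enc) := by
  have h1 := completes_teleportAll (completes_done enc)
    -- The edge registers, reset to `0` by the preparation, count as used and form the initial
    -- garbage factor.
    (fun x => if ∀ a, (x (.edge a) : ℕ) = 0 then 1 else 0) (by
      intro x y hxy
      have : ∀ a, x (.edge a) = y (.edge a) := fun a => hxy _ trivial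
      simp only [this])
  have h2 := conveys_prepare hcap (fun a => enc a) (nodup_orientedEdges N)
    (h1.congr (φ := fun x a => if ρ.inputs x = enc a ∧ ∀ e, Prepared ∅ e x then 1 else 0)
      fun x a => indicator_mul_indicator ?_)
  -- Restores the normalization of the edge states.
  · have h3 := h2.smul (∏ e ∈ N.graph.edgeFinset, ((Real.sqrt (N.d e) : ℝ) : ℂ)⁻¹)
    refine LOCC.Conveys.congr (φ := fun x a => ρ.resource x * if ρ.inputs x = enc a then 1 else 0)
      h3 fun x a => ?_
    have hfresh : (∀ e, Prepared {e | e ∈ (orientedEdges N).map SimpleGraph.Dart.edge} e x) ↔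
        (∀ e, ρ.Fresh e x) := by
      refine forall_congr' fun e => ⟨fun h => ?_, fun h => ⟨fun _ => h, fun he => ?_⟩⟩
      · by_cases he : e ∈ N.graph.edgeSet
        · exact h.1 (mem_map_edge_orientedEdges.mpr he)
        · exact ⟨fun b hb => absurd (hb ▸ b.edge_mem) he,
            fun i j hb => absurd (hb ▸ (ρ.hopDart ⟨i, j⟩).edge_mem) he⟩
      -- For pairs that are not edges, both `Fresh` and `Ready` hold vacuously.
      · have he' : e ∉ N.graph.edgeSet := fun h' => he (mem_map_edge_orientedEdges.mpr h')
        exact ⟨fun b hb => absurd (hb ▸ b.edge_mem) he',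
          fun i j hb => absurd (hb ▸ (ρ.hopDart ⟨i, j⟩).edge_mem) he'⟩
    have hr : ρ.resource x = (∏ e ∈ N.graph.edgeFinset, ((Real.sqrt (N.d e) : ℝ) : ℂ)⁻¹) *
        if ∀ e, ρ.Fresh e x then 1 else 0 := by
      rw [resource, mul_ite, mul_one, mul_zero]
      exact if_congr forall_fresh_iff.symm rfl rfl
    rw [hr, mul_assoc]
    refine congrArg (_ * ·) (indicator_mul_indicator (p := ∀ e, ρ.Fresh e x)
      (q := ρ.inputs x = enc a) (r := ρ.inputs x = enc a ∧
        ∀ e, Prepared {e | e ∈ (orientedEdges N).map SimpleGraph.Dart.edge} e x) ?_).symm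
    rw [hfresh, and_comm]
  · rw [prepared_empty_iff]
    constructor
    · rintro ⟨h, h'⟩
      exact ⟨funext fun i => Fin.ext (h' i).1, h, fun i j => (h' i).2 j (Nat.zero_le _)⟩
    · rintro ⟨h, h', h''⟩
      exact ⟨h', fun i => ⟨congrArg Fin.val (congrFun h i), fun j _ => h'' i j⟩⟩

theorem protocol_transmits (hcap : ∀ a, ρ.load a * ρ.load a.symm ≤ N.d a.edge)
    (hD : D = ∏ i, ρ.dim i) : (ρ.protocol hcap).Transmits D := by
  classical
  have enc : Fin D ≃ ∀ i, Fin (ρ.dim i) := Fintype.equivOfCardEq (by simp [hD])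
  refine ⟨enc, fun τ => ?_⟩
  obtain ⟨w, hw⟩ := conveys_protocol enc hcap
  have hw' : ∀ τ, ρ.reduced enc ((ρ.protocol hcap).toLOCC.run (ρ.initial enc τ)) = w • τ := by
    intro τ
    rw [initial_eq]
    exact hw τ
  suffices h : w = 1 by
    have := hw' τ
    rwa [h, one_smul] at this
  -- One basis state as input suffices to determine the scalar by its trace.
  let a : Fin D := enc.symm fun i => ⟨0, ρ.dim_pos i⟩
  have h1 := (LOCC.trace_run _ _).symm.trans ((ρ.trace_reduced enc _).symm.trans
    (congrArg Matrix.trace (hw' (Matrix.single a a 1))))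
  rw [Matrix.trace_smul, Matrix.trace_single_eq_same, smul_eq_mul,
    mul_one] at h1
  rw [← h1]
  refine Eq.trans ?_ (ρ.sum_resource (enc a))
  refine Finset.sum_congr rfl fun x _ => ?_
  rw [Matrix.diag_apply, initial]
  by_cases hx : ρ.inputs x = enc a
  · simp [hx]
  · have : a ≠ enc.symm (ρ.inputs x) := fun h => hx (by rw [h, Equiv.apply_symm_apply])
    simp [hx, this]

end Routing

end QuantumTensorNetwork

/-! ### Decomposition of flows into paths -/

namespace QuantumTensorNetwork

variable {V : Type u}

/-! ### Counting the passages of a walk. -/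

section Passes

variable {G : SimpleGraph V}

open Classical in
/-- How often a walk traverses an edge in the direction from `x` to `y`. -/
noncomputable def passes {u v : V} (w : G.Walk u v) (x y : V) : ℕ :=
  (w.darts.map (·.toProd)).count (x, y)

variable {u v : V} (w : G.Walk u v)

open Classical in
theorem passes_dart (a : G.Dart) : passes w a.fst a.snd = w.darts.count a := by
  rw [passes]
  exact List.count_map_of_injective _ _ SimpleGraph.Dart.toProd_injective a

theorem passes_eq_zero {x y : V} (h : ¬ G.Adj x y) : passes w x y = 0 := by
  classical
  rw [passes, List.count_eq_zero]
  intro hm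
  obtain ⟨a, _, ha⟩ := List.mem_map.mp hm
  have := a.adj
  rw [ha] at this
  exact h this

variable [Fintype V]

theorem sum_count_fst [DecidableEq V] (L : List (V × V)) (y : V) :
    ∑ x, L.count (x, y) = (L.map Prod.snd).count y := by
  induction L with
  | nil => simp
  | cons z L ih =>
    simp only [List.count_cons, List.map_cons, Finset.sum_add_distrib, ih]
    congr 1
    obtain ⟨a, b⟩ := z
    by_cases h : b = y <;> simp [h]

theorem sum_count_snd [DecidableEq V] (L : List (V × V)) (x : V) :
    ∑ y, L.count (x, y) = (L.map Prod.fst).count x := by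
  induction L with
  | nil => simp
  | cons z L ih =>
    simp only [List.count_cons, List.map_cons, Finset.sum_add_distrib, ih]
    congr 1
    obtain ⟨a, b⟩ := z
    by_cases h : a = x <;> simp [h]

open Classical in
theorem sum_passes_in (y : V) : ∑ x, passes w x y = w.support.tail.count y := by
  simp only [passes]
  rw [sum_count_fst, List.map_map, ← SimpleGraph.Walk.map_snd_darts]
  rfl

open Classical in
theorem sum_passes_out (x : V) : ∑ y, passes w x y = w.support.dropLast.count x := by
  simp only [passes]
  rw [sum_count_snd, List.map_map, ← SimpleGraph.Walk.map_fst_darts]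
  rfl

omit [Fintype V] in
open Classical in
theorem count_support_eq_tail (x : V) :
    w.support.count x = w.support.tail.count x + if u = x then 1 else 0 := by
  rw [← w.cons_tail_support, List.count_cons]
  simp

omit [Fintype V] in
open Classical in
theorem count_support_eq_dropLast (x : V) :
    w.support.count x = w.support.dropLast.count x + if v = x then 1 else 0 := by
  conv_lhs => rw [← List.dropLast_append_getLast w.support_ne_nil]
  rw [List.count_append, SimpleGraph.Walk.getLast_support, List.count_singleton]
  simp

/-- Away from the two ends, entering and leaving a vertex are both counted by its occurrences in the
support. -/
theorem sum_passes_in_eq_out {x : V} (hu : x ≠ u) (hv : x ≠ v) :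
    ∑ y, passes w y x = ∑ y, passes w x y := by
  classical
  have h1 := count_support_eq_tail w x
  have h2 := count_support_eq_dropLast w x
  rw [if_neg hu.symm] at h1
  rw [if_neg hv.symm] at h2
  rw [sum_passes_in, sum_passes_out]
  omega

variable {w}

theorem sum_passes_in_start (hw : w.IsPath) : ∑ y, passes w y u = 0 := by
  classical
  have h1 := count_support_eq_tail w u
  rw [if_pos rfl] at h1
  have h2 := List.nodup_iff_count_le_one.mp hw.support_nodup u
  rw [sum_passes_in]
  omega

theorem sum_passes_out_start (hw : w.IsPath) (huv : u ≠ v) : ∑ y, passes w u y = 1 := by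
  classical
  have h1 := count_support_eq_dropLast w u
  rw [if_neg huv.symm] at h1
  rw [sum_passes_out]
  have h2 := List.count_eq_one_of_mem hw.support_nodup w.start_mem_support
  omega

theorem sum_passes_out_end (hw : w.IsPath) : ∑ y, passes w v y = 0 := by
  classical
  have h1 := count_support_eq_dropLast w v
  rw [if_pos rfl] at h1
  have h2 := List.nodup_iff_count_le_one.mp hw.support_nodup v
  rw [sum_passes_out]
  omega

theorem passes_le_one (hw : w.IsPath) (x y : V) : passes w x y ≤ 1 := by
  classical
  have h0 : passes w x y ≤ ∑ y, passes w x y :=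
    Finset.single_le_sum (fun _ _ => Nat.zero_le _) (Finset.mem_univ y)
  have h1 := count_support_eq_dropLast w x
  have h2 := List.nodup_iff_count_le_one.mp hw.support_nodup x
  rw [sum_passes_out] at h0
  omega

end Passes

/-! ### Splitting prime paths off a flow. -/

variable [Fintype V] {N : QuantumTensorNetwork V}

/-- The properties of strict flows that are needed to split off paths. -/
structure IsSourceFlow (N : QuantumTensorNetwork V) (f : V → V → ℕ) : Prop where
  pos : ∀ u v, N.graph.Adj u v → 0 < f u v
  conservation : ∀ v, v ≠ N.s → v ≠ N.t → N.inflow f v = N.outflow f v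
  source : ∀ v, N.graph.Adj N.s v → f v N.s = 1

theorem IsStrictFlow.isSourceFlow {f : V → V → ℕ} (hf : N.IsStrictFlow f) : N.IsSourceFlow f where
  pos u v h := Nat.pos_of_ne_zero fun h0 => by
    have := (hf.capacity u v h).1
    simp [h0] at this
  conservation := hf.conservation
  source := hf.source

theorem inflow_source {f : V → V → ℕ} (hf : ∀ v, N.graph.Adj N.s v → f v N.s = 1) :
    N.inflow f N.s = 1 := by
  refine Finset.prod_eq_one fun u _ => ?_
  split_ifs with h
  · exact hf u h.symm
  · rfl

open Classical in
-- Valuations turn multiplicative conservation into the usual additive one.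
theorem IsSourceFlow.factorization_inflow {f : V → V → ℕ} (hf : N.IsSourceFlow f) (p : ℕ) (v : V) :
    (N.inflow f v).factorization p =
      ∑ u, if N.graph.Adj u v then (f u v).factorization p else 0 := by
  rw [inflow, Nat.factorization_prod_apply]
  · refine Finset.sum_congr rfl fun u _ => ?_
    split_ifs <;> simp
  · intro u _
    split_ifs with h
    · exact (hf.pos u v h).ne'
    · exact one_ne_zero

open Classical in
theorem IsSourceFlow.factorization_outflow {f : V → V → ℕ} (hf : N.IsSourceFlow f) (p : ℕ) (v : V) :
    (N.outflow f v).factorization p =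
      ∑ u, if N.graph.Adj v u then (f v u).factorization p else 0 := by
  rw [outflow, Nat.factorization_prod_apply]
  · refine Finset.sum_congr rfl fun u _ => ?_
    split_ifs <;> simp
  · intro u _
    split_ifs with h
    · exact (hf.pos v u h).ne'
    · exact one_ne_zero

theorem IsSourceFlow.outflow_pos {f : V → V → ℕ} (hf : N.IsSourceFlow f) (v : V) :
    0 < N.outflow f v := by
  refine Finset.prod_pos fun u _ => ?_
  split_ifs with h
  · exact hf.pos v u h
  · exact one_pos

/-- If a prime divides what leaves the source, then it divides the flow along a whole path from
the source to the sink. -/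
theorem IsSourceFlow.exists_isPath {f : V → V → ℕ} (hf : N.IsSourceFlow f) {p : ℕ} (hp : p.Prime)
    (hpf : p ∣ N.outflow f N.s) :
    ∃ w : N.graph.Walk N.s N.t, w.IsPath ∧ ∀ a ∈ w.darts, p ∣ f a.fst a.snd := by
  classical
  -- The vertices reachable from the source along flow values divisible by `p`; the sink is shown to
  -- be among them.
  let S : Finset V := Finset.univ.filter fun v =>
    ∃ w : N.graph.Walk N.s v, ∀ a ∈ w.darts, p ∣ f a.fst a.snd
  have hS : ∀ v, v ∈ S ↔ ∃ w : N.graph.Walk N.s v, ∀ a ∈ w.darts, p ∣ f a.fst a.snd := by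
    simp [S]
  by_cases ht : N.t ∈ S
  · obtain ⟨w, hw⟩ := (hS _).mp ht
    -- Cutting out cycles keeps only darts of the walk, hence the divisibility.
    exact ⟨w.bypass, w.bypass_isPath, fun a ha => hw a (w.darts_bypass_subset_darts ha)⟩
  exfalso
  have hs : N.s ∈ S := (hS _).mpr ⟨.nil, by simp⟩
  let φ : V → V → ℕ := fun u v => if N.graph.Adj u v then (f u v).factorization p else 0
  have hleave : ∀ v ∈ S, ∀ u, u ∉ S → φ v u = 0 := by
    intro v hv u hu
    simp only [φ]
    split_ifs with h
    · refine Nat.factorization_eq_zero_of_not_dvd fun hd => hu ?_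
      obtain ⟨w, hw⟩ := (hS _).mp hv
      refine (hS _).mpr ⟨w.concat h, fun a ha => ?_⟩
      rw [SimpleGraph.Walk.darts_concat, List.concat_eq_append, List.mem_append,
        List.mem_singleton] at ha
      rcases ha with ha | rfl
      · exact hw a ha
      · exact hd
    · rfl
  have hout : ∀ v, (N.outflow f v).factorization p = ∑ u, φ v u := hf.factorization_outflow p
  have hin : ∀ v, (N.inflow f v).factorization p = ∑ u, φ u v := hf.factorization_inflow p
  -- If the sink is not in `S`, then all of `S` except the source is balanced, and the source has a
  -- positive surplus.
  have hlt : ∑ v ∈ S, ∑ u, φ u v < ∑ v ∈ S, ∑ u, φ v u := by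
    refine Finset.sum_lt_sum (fun v hv => ?_) ⟨N.s, hs, ?_⟩
    · rw [← hin, ← hout]
      by_cases h : v = N.s
      · rw [h, inflow_source hf.source]
        simp
      · rw [hf.conservation v h fun h' => ht (h' ▸ hv)]
    · rw [← hin, ← hout, inflow_source hf.source]
      simpa using hp.factorization_pos_of_dvd (hf.outflow_pos _).ne' hpf
  -- But no valuation leaves `S`, so everything flowing out of its vertices is also counted as
  -- flowing in.
  refine absurd hlt (not_lt.mpr ?_)
  calc ∑ v ∈ S, ∑ u, φ v u = ∑ v ∈ S, ∑ u ∈ S, φ v u :=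
        Finset.sum_congr rfl fun v hv => (Finset.sum_subset (Finset.subset_univ S) fun u _ hu =>
          hleave v hv u hu).symm
    _ = ∑ u ∈ S, ∑ v ∈ S, φ v u := Finset.sum_comm
    _ ≤ ∑ u ∈ S, ∑ v, φ v u :=
        Finset.sum_le_sum fun u _ => Finset.sum_le_sum_of_subset (Finset.subset_univ S)

theorem inflow_eq_pow_mul {f g : V → V → ℕ} {p : ℕ} {w : N.graph.Walk N.s N.t}
    (h : ∀ u v, N.graph.Adj u v → f u v = p ^ passes w u v * g u v) (v : V) :
    N.inflow f v = p ^ (∑ u, passes w u v) * N.inflow g v := by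
  rw [inflow, inflow, ← Finset.prod_pow_eq_pow_sum, ← Finset.prod_mul_distrib]
  refine Finset.prod_congr rfl fun u _ => ?_
  split_ifs with hadj
  · exact h u v hadj
  · rw [passes_eq_zero w hadj, pow_zero, one_mul]

theorem outflow_eq_pow_mul {f g : V → V → ℕ} {p : ℕ} {w : N.graph.Walk N.s N.t}
    (h : ∀ u v, N.graph.Adj u v → f u v = p ^ passes w u v * g u v) (v : V) :
    N.outflow f v = p ^ (∑ u, passes w v u) * N.outflow g v := by
  rw [outflow, outflow, ← Finset.prod_pow_eq_pow_sum, ← Finset.prod_mul_distrib]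
  refine Finset.prod_congr rfl fun u _ => ?_
  split_ifs with hadj
  · exact h v u hadj
  · rw [passes_eq_zero w hadj, pow_zero, one_mul]

/-! ### The flow defined by a routing. -/

namespace Routing

/-- The total dimension carried from `u` to `v`. -/
noncomputable def flow (ρ : Routing N) (u v : V) : ℕ := ∏ i, ρ.dim i ^ passes (ρ.route i) u v

omit [Fintype V] in
theorem flow_dart (ρ : Routing N) (a : N.graph.Dart) : ρ.flow a.fst a.snd = ρ.load a := by
  simp only [flow, load, passes_dart]

theorem inflow_flow (ρ : Routing N) (v : V) :
    N.inflow ρ.flow v = ∏ i, ρ.dim i ^ ∑ u, passes (ρ.route i) u v := by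
  simp only [← Finset.prod_pow_eq_pow_sum]
  rw [inflow, Finset.prod_comm]
  refine Finset.prod_congr rfl fun u _ => ?_
  split_ifs with h
  · rfl
  · simp [passes_eq_zero _ h]

theorem outflow_flow (ρ : Routing N) (v : V) :
    N.outflow ρ.flow v = ∏ i, ρ.dim i ^ ∑ u, passes (ρ.route i) v u := by
  simp only [← Finset.prod_pow_eq_pow_sum]
  rw [outflow, Finset.prod_comm]
  refine Finset.prod_congr rfl fun u _ => ?_
  split_ifs with h
  · rfl
  · simp [passes_eq_zero _ h]

variable {ρ : Routing N}

theorem outflow_flow_source (hpath : ∀ i, (ρ.route i).IsPath) : N.outflow ρ.flow N.s = ∏ i, ρ.dim i := by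
  rw [outflow_flow]
  exact Finset.prod_congr rfl fun i _ => by rw [sum_passes_out_start (hpath i) N.s_ne_t, pow_one]

theorem flow_source (hpath : ∀ i, (ρ.route i).IsPath) (v : V) : ρ.flow v N.s = 1 := by
  refine Finset.prod_eq_one fun i _ => ?_
  have := (Finset.sum_eq_zero_iff.mp (sum_passes_in_start (hpath i))) v (Finset.mem_univ v)
  rw [this, pow_zero]

theorem flow_sink (hpath : ∀ i, (ρ.route i).IsPath) (u : V) : ρ.flow N.t u = 1 := by
  refine Finset.prod_eq_one fun i _ => ?_
  have := (Finset.sum_eq_zero_iff.mp (sum_passes_out_end (hpath i))) u (Finset.mem_univ u)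
  rw [this, pow_zero]

theorem flowValue_flow (hpath : ∀ i, (ρ.route i).IsPath) : N.flowValue ρ.flow = ((∏ i, ρ.dim i : ℕ) : ℚ) := by
  rw [flowValue, outflow_flow_source hpath, inflow_source fun v _ => flow_source hpath v]
  simp

/-- If a routing along paths respects the capacities, then it defines a strict flow. -/
theorem isStrictFlow_flow (hpath : ∀ i, (ρ.route i).IsPath)
    (hcap : ∀ u v, N.graph.Adj u v → ρ.flow v u * ρ.flow u v ≤ N.d s(u, v)) :
    N.IsStrictFlow ρ.flow where
  capacity u v h := by
    have hpos : ∀ u v, 0 < ρ.flow u v := fun u v =>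
      Finset.prod_pos fun i _ => pow_pos (ρ.dim_pos i) _
    exact ⟨Nat.mul_pos (hpos v u) (hpos u v), hcap u v h⟩
  conservation v hs ht := by
    rw [inflow_flow, outflow_flow]
    exact Finset.prod_congr rfl fun i _ => by rw [sum_passes_in_eq_out _ hs ht]
  source v _ := flow_source hpath v
  sink u _ := flow_sink hpath u

end Routing

/-- Every flow out of the source dominates a system of paths with prime dimensions which carries
all of what leaves the source. -/
theorem IsSourceFlow.exists_routing {f : V → V → ℕ} (hf : N.IsSourceFlow f) :
    ∃ ρ : Routing N, (∀ i, (ρ.dim i).Prime) ∧ (∀ i, (ρ.route i).IsPath) ∧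
      (∀ u v, N.graph.Adj u v → ρ.flow u v ∣ f u v) ∧ ∏ i, ρ.dim i = N.outflow f N.s := by
  induction hD : N.outflow f N.s using Nat.strong_induction_on generalizing f with
  | _ D ih =>
    by_cases h1 : D = 1
    · exact ⟨⟨0, Fin.elim0, fun i => i.elim0, fun i => i.elim0⟩, fun i => i.elim0,
        fun i => i.elim0, fun u v _ => by simp [Routing.flow], by simp [h1]⟩
    obtain ⟨p, hp, hpD⟩ := Nat.exists_prime_and_dvd h1
    obtain ⟨w, hw, hwf⟩ := hf.exists_isPath hp (hD ▸ hpD)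
    -- A path passes each dart at most once, so `p` is divided out exactly along its darts, where it
    -- divides `f`.
    let g : V → V → ℕ := fun u v => f u v / p ^ passes w u v
    have hfg : ∀ u v, N.graph.Adj u v → f u v = p ^ passes w u v * g u v := by
      intro u v h
      refine (Nat.mul_div_cancel' ?_).symm
      rcases Nat.le_one_iff_eq_zero_or_eq_one.mp (passes_le_one hw u v) with h0 | h0
      · simp [h0]
      · rw [h0, pow_one]
        classical
        have hc := passes_dart w ⟨(u, v), h⟩
        exact hwf ⟨(u, v), h⟩ (List.count_pos_iff.mp (by rw [← hc]; exact h0 ▸ one_pos))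
    have hg : N.IsSourceFlow g := by
      refine ⟨fun u v h => ?_, fun v hs ht => ?_, fun v h => ?_⟩
      · have := hf.pos u v h
        rw [hfg u v h] at this
        exact Nat.pos_of_mul_pos_left this
      · have := hf.conservation v hs ht
        rw [inflow_eq_pow_mul hfg, outflow_eq_pow_mul hfg, sum_passes_in_eq_out w hs ht] at this
        exact Nat.eq_of_mul_eq_mul_left (pow_pos hp.pos _) this
      · have := hf.source v h
        rw [hfg v N.s h.symm] at this
        exact Nat.eq_one_of_mul_eq_one_left this
    have hgD : D = p * N.outflow g N.s := by
      rw [← hD, outflow_eq_pow_mul hfg, sum_passes_out_start hw N.s_ne_t, pow_one]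
    -- The path leaves the source exactly once, so the outflow drops by the factor `p`.
    have hlt : N.outflow g N.s < D := by
      rw [hgD]
      exact lt_mul_of_one_lt_left (hg.outflow_pos _) hp.one_lt
    obtain ⟨ρ, h2, h3, h4, h5⟩ := ih _ hlt hg rfl
    refine ⟨⟨ρ.n + 1, Fin.cons p ρ.dim, ?_,
      Fin.cons (α := fun _ => N.graph.Walk N.s N.t) w ρ.route⟩, ?_, ?_, ?_, ?_⟩
    · exact Fin.cases hp.pos ρ.dim_pos
    · exact Fin.cases hp h2
    · exact Fin.cases hw h3
    · intro u v h
      rw [Routing.flow, Fin.prod_univ_succ, hfg u v h]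
      exact Nat.mul_dvd_mul_left _ (h4 u v h)
    · rw [Fin.prod_univ_succ, hgD, ← h5]
      rfl

theorem isStrictFlow_one : N.IsStrictFlow fun _ _ => 1 where
  capacity u v h := ⟨le_rfl, by have := N.two_le_d s(u, v) h; omega⟩
  conservation v _ _ := by simp [inflow, outflow]
  source _ _ := rfl
  sink _ _ := rfl

variable (N) in
/-- The maximum value of a strict flow is attained. -/
theorem exists_isStrictFlow_flowValue_eq :
    ∃ f, N.IsStrictFlow f ∧ N.qmfStrict = (N.outflow f N.s : ℝ) := by
  classical
  have hval : ∀ f, N.IsStrictFlow f → (N.flowValue f : ℝ) = (N.outflow f N.s : ℝ) := by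
    intro f hf
    rw [flowValue, inflow_source hf.source]
    simp
  have hne : {x : ℝ | ∃ f : V → V → ℕ, N.IsStrictFlow f ∧ x = (N.flowValue f : ℝ)}.Nonempty :=
    ⟨_, _, isStrictFlow_one, rfl⟩
  have hfin : {x : ℝ | ∃ f : V → V → ℕ, N.IsStrictFlow f ∧ x = (N.flowValue f : ℝ)}.Finite := by
    -- Values are natural numbers bounded by the capacities around the source, so the supremum is
    -- over a finite set.
    refine ((Set.finite_Iic (∏ u, if N.graph.Adj N.s u then N.d s(N.s, u) else 1)).image
      (Nat.cast : ℕ → ℝ)).subset ?_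
    rintro _ ⟨f, hf, rfl⟩
    refine ⟨N.outflow f N.s, ?_, (hval f hf).symm⟩
    rw [Set.mem_Iic, outflow]
    refine Finset.prod_le_prod' fun u _ => ?_
    split_ifs with h
    · have := (hf.capacity N.s u h).2
      rwa [hf.source u h, one_mul] at this
    · exact le_rfl
  obtain ⟨f, hf, hx⟩ := hne.csSup_mem hfin
  exact ⟨f, hf, hx.trans (hval f hf)⟩

end QuantumTensorNetwork

/-! ### From a maximal flow to the protocol. -/

theorem mainTheorem7 {V : Type*} [Fintype V] (N : QuantumTensorNetwork V)
    (h : N.qmfStrict = (N.qmc : ℝ)) :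
    ∃ (f : V → V → ℕ) (P : N.TeleportationProtocol),
      N.IsStrictFlow f ∧ N.flowValue f = (N.qmc : ℚ) ∧
      (∀ i, (P.dim i).Prime) ∧ (∀ i, (P.route i).IsPath) ∧
      (∀ a : N.graph.Dart, f a.fst a.snd = P.toRouting.load a) ∧
      P.Transmits N.qmc := by
  obtain ⟨f, hf, hmax⟩ := N.exists_isStrictFlow_flowValue_eq
  have hD : N.outflow f N.s = N.qmc := by exact_mod_cast hmax.symm.trans h
  obtain ⟨ρ, hprime, hpath, hdvd, hprod⟩ := hf.isSourceFlow.exists_routing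
  -- Positive products of divisors stay below the capacities that bound the original flow.
  have hcap : ∀ u v, N.graph.Adj u v → ρ.flow v u * ρ.flow u v ≤ N.d s(u, v) := by
    intro u v hadj
    have hle := hf.capacity u v hadj
    exact (Nat.le_of_dvd hle.1 (Nat.mul_dvd_mul (hdvd v u hadj.symm) (hdvd u v hadj))).trans hle.2
  have hload : ∀ a, ρ.load a * ρ.load a.symm ≤ N.d a.edge := by
    intro a
    rw [← ρ.flow_dart, ← ρ.flow_dart, mul_comm]
    exact hcap a.fst a.snd a.adj
  -- The flow of the routes replaces `f`, which may have further factors on circulations; both have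
  -- the same value.
  refine ⟨ρ.flow, ρ.protocol hload, QuantumTensorNetwork.Routing.isStrictFlow_flow hpath hcap, ?_, hprime, hpath,
    ρ.flow_dart, QuantumTensorNetwork.Routing.protocol_transmits hload ?_⟩
  · rw [QuantumTensorNetwork.Routing.flowValue_flow hpath, hprod, hD]
  · rw [hprod, hD]
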